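/- Let $\varepsilon_0>0$ and, for $\varepsilon\in(0,\varepsilon_0]$, let $\rho_\varepsilon>0$ and $0<d_\varepsilon<\rho_\varepsilon/2$, with $\rho_\varepsilon\to0$ as $\varepsilon\to0$. In the plane, consider the straight passages $$T_{k,\varepsilon}=\{(x_1,x_2)\in\mathbb R^2:\ |x_1-\rho_\varepsilon k|<d_\varepsilon,\ |x_2|<\varepsilon\},\qquad k\in\mathbb Z,$$ the half-discs $$B_{k,\varepsilon}^{\pm}=\{(x_1,x_2):\ (x_1-\rho_\varepsilon k)^2+(x_2\mp\varepsilon)^2<(\rho_\varepsilon/2)^2,\ \pm x_2>\varepsilon\},$$ the semicircles $S_{k,\varepsilon}^{\pm}=\partial B_{k,\varepsilon}^{\pm}\setminus\{\pm x_2=\varepsilon\}$, and the domain $G_{k,\varepsilon}=\operatorname{int}\big(\overline{T_{k,\varepsilon}\cup B_{k,\varepsilon}^+\cup B_{k,\varepsilon}^-}\big)$. Define $$\mathscr C_{k,\varepsilon}=\inf\Big\{\|\nabla U\|^2_{L^2(G_{k,\varepsilon})}:\ U\in H^1(G_{k,\varepsilon}),\ U=1\text{ on }S_{k,\varepsilon}^+,\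 U=0\text{ on }S_{k,\varepsilon}^-\Big\},$$ where the boundary values are understood in the sense of traces. (Up to translation, $G_{k,\varepsilon}$ does not depend on $k$, so neither does $\mathscr C_{k,\varepsilon}$.) Put $$p_\varepsilon=|\ln d_\varepsilon|^{-1}\rho_\varepsilon^{-1},\qquad q_\varepsilon=d_\varepsilon\,\varepsilon^{-1}\rho_\varepsilon^{-1},$$ and assume that, as $\varepsilon\to0$, $p_\varepsilon\to p\in(0,\infty)$ and $q_\varepsilon\to q\in(0,\infty]$. Then, with the convention $q^{-1}=0$ if $q=\infty$, as $\varepsilon\to0$, $$\mathscr C_{0,\varepsilon}=\frac{\pi p}{2+\pi p\,q^{-1}}\;\rho_\varepsilon\Big(1+\mathcal O\big(\rho_\varepsilon|\ln\rho_\varepsilon|+|q_\varepsilon^{-1}-q^{-1}|+|p_\varepsilon-p|\big)\Big).$$ -/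

import Mathlib

open Filter Topology MeasureTheory Asymptotics
open scoped ENNReal ContDiff

noncomputable section

namespace NeumannSieve

/-- The Euclidean plane; the coordinates of `x` are `x 0` (along the sieve) and `x 1`. -/
abbrev Plane : Type := EuclideanSpace ℝ (Fin 2)

/-! ### Sobolev functions and traces -/

/-- `F` is the weak gradient of `u` in the open set `G`. -/
def HasWeakGradient (G : Set Plane) (u : Plane → ℝ) (F : Plane → Plane) : Prop :=
  ∀ φ : Plane → ℝ, ContDiff ℝ ∞ φ → HasCompactSupport φ → tsupport φ ⊆ G →
    ∫ x in G, u x • gradient φ x = -∫ x in G, φ x • F x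

/-- `u` belongs to the Sobolev space `H¹(G)` and `F` is its weak gradient. -/
structure MemH1 (G : Set Plane) (u : Plane → ℝ) (F : Plane → Plane) : Prop where
  memLp : MemLp u 2 (volume.restrict G)
  memLp_grad : MemLp F 2 (volume.restrict G)
  weakGradient : HasWeakGradient G u F

/-- The function `u ∈ H¹(G)`, with weak gradient `F`, has the trace `g` on the part `S` of the
boundary of `G`: the trace operator is the continuous extension to `H¹(G)` of the restriction
of functions that are smooth up to the boundary. So `u` is a limit in `H¹(G)` of `C¹` functions
whose restrictions to `S` converge to `g` in `L²(S)`, with respect to arc length. -/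
def HasTrace (G S : Set Plane) (u : Plane → ℝ) (F : Plane → Plane) (g : Plane → ℝ) : Prop :=
  ∃ φ : ℕ → Plane → ℝ, (∀ j, ContDiff ℝ 1 (φ j)) ∧
    Tendsto (fun j => eLpNorm (fun x => φ j x - u x) 2 (volume.restrict G)) atTop (𝓝 0) ∧
    Tendsto (fun j => eLpNorm (fun x => gradient (φ j) x - F x) 2 (volume.restrict G))
      atTop (𝓝 0) ∧
    Tendsto (fun j => eLpNorm (fun x => φ j x - g x) 2 ((Measure.hausdorffMeasure 1).restrict S))
      atTop (𝓝 0)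

/-! ### The geometry

Here `ε` is the half-thickness of the sieve, `ρ` the period, `d` the half-width of the passages,
`k` the number of the passage, and `s = 1` or `s = -1` selects the upper or the lower side. -/

/-- The straight passage number `k`. -/
def passage (ε ρ d : ℝ) (k : ℤ) : Set Plane := {x | |x 0 - ρ * k| < d ∧ |x 1| < ε}

/-- The half-plane above (`s = 1`) or below (`s = -1`) the sieve. -/
def halfPlane (ε s : ℝ) : Set Plane := {x | ε < s * x 1}

/-- The boundary line of `halfPlane ε s`. -/
def sideLine (ε s : ℝ) : Set Plane := {x | s * x 1 = ε}

/-- The half-disc of radius `ρ / 2` outside the sieve, centred at the middle of the upper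
(`s = 1`) or lower (`s = -1`) end of passage `k`. -/
def halfDisc (ε ρ : ℝ) (k : ℤ) (s : ℝ) : Set Plane :=
  Metric.ball (!₂[ρ * k, s * ε] : Plane) (ρ / 2) ∩ halfPlane ε s

/-- The curved part of the boundary of the half-disc. -/
def semicircle (ε ρ : ℝ) (k : ℤ) (s : ℝ) : Set Plane :=
  frontier (halfDisc ε ρ k s) \ sideLine ε s

/-- The passage together with the two half-discs at its ends. -/
def cell (ε ρ d : ℝ) (k : ℤ) : Set Plane :=
  interior (closure (passage ε ρ d k ∪ halfDisc ε ρ k 1 ∪ halfDisc ε ρ k (-1)))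

/-! ### The capacity-type quantity -/

/-- `u ∈ H¹(cell)`, with weak gradient `F`, equals `1` on the upper semicircle and `0` on the lower
semicircle in the sense of traces. -/
def Admissible (ε ρ d : ℝ) (k : ℤ) (u : Plane → ℝ) (F : Plane → Plane) : Prop :=
  MemH1 (cell ε ρ d k) u F ∧
    HasTrace (cell ε ρ d k) (semicircle ε ρ k 1 ∪ semicircle ε ρ k (-1)) u F
      ((semicircle ε ρ k 1).indicator fun _ => 1)

/-- The infimum of the Dirichlet integral over the cell among all admissible functions. -/
def capacity (ε ρ d : ℝ) (k : ℤ) : ℝ :=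
  sInf {E : ℝ | ∃ u F, Admissible ε ρ d k u F ∧ E = ∫ x in cell ε ρ d k, ‖F x‖ ^ 2}

/-- `p_ε = |ln d|⁻¹ ρ⁻¹`. -/
def pParam (ρ d : ℝ) : ℝ := |Real.log d|⁻¹ * ρ⁻¹

/-- `q_ε = d ε⁻¹ ρ⁻¹`. -/
def qParam (ε ρ d : ℝ) : ℝ := d * ε⁻¹ * ρ⁻¹

end NeumannSieve

end

/-!
The capacity is the conductance of the cell, and the cell is a series connection of a passage of
length `2 ε` and width `2 d`, of resistance `ε / d`, and of two half-discs. In each half-disc the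
flux spreads radially from the mouth of the passage to the semicircle, so that the resistance is
`log (ρ / d) / π` up to a bounded amount. Hence the inverse of the capacity differs by a bounded
amount from `resistance ε ρ d = ε / d + (2 / π) (log ρ - log d)`, which is
`ρ⁻¹ (1 / q_ε + 2 / (π p_ε) + (2 / π) ρ log ρ)`. Since the resistance is of order `ρ⁻¹`, the bounded
amount is a relative error of order `ρ`.

*Lower bound.* Let `φ` be `C¹` on the plane. Along the passage and along the rays of each half-disc
the differences of the means of `φ` are integrals of the derivative. Only the passage from the
mean over a mouth to the mean over the half-circle of radius `d` needs an idea: the mouth consists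
of the rays `θ = 0` and `θ = π`, hence its mean can be compared, circle by circle, with the mean
over the half-disc of radius `d` with respect to `dr dθ`, and the latter with the mean over the
half-circle by an integration by parts in `r` (`half_estimate_aux`). Young's inequality with a free
parameter `l` turns each of these bounds into the form `(l * resistance + energy / l) / 2`, and such
bounds add up (`abs_arcMean_sub_arcMean_le`). An admissible function is a limit of `C¹` functions,
and its trace controls the means over the semicircles because the angular measure is bounded by a
multiple of the arc length (`tendsto_arcMean`); the choice of `l` as the inverse of the total
resistance gives `inv_resistanceBound_le`.

*Upper bound.* The potential of a unit flux, radial in the half-discs and linear in the passage, is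
smoothed to a `C¹` function on the whole plane, which is its own approximating sequence in the
definition of the trace. The smoothing costs a bounded part of the potential drop
(`sub_two_le_potentialEnd`) and does not raise the energy (`potential_energy_le`).
-/

namespace NeumannSieve

/-! ### The pieces of the cell -/

lemma measurePreserving_mk :
    MeasurePreserving (fun p : ℝ × ℝ => (!₂[p.1, p.2] : Plane)) :=
  (EuclideanSpace.volume_preserving_symm_measurableEquiv_toLp (Fin 2)).symm.comp
    (volume_preserving_finTwoArrow ℝ).symm

lemma measurableEmbedding_of_injective {f : ℝ × ℝ → Plane} (hf : Continuous f)
    (hi : Function.Injective f) : MeasurableEmbedding f :=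
  hf.measurable.measurableEmbedding hi

/-- The point with polar coordinates `r`, `θ` around the centre of the half-disc on the side `s`;
the angle is measured so that `0 < θ < π` inside the half-disc on either side. -/
noncomputable def polarPoint (ε s r θ : ℝ) : Plane :=
  !₂[r * Real.cos θ, s * (ε + r * Real.sin θ)]

@[simp] lemma polarPoint_zero (ε s r θ : ℝ) : polarPoint ε s r θ 0 = r * Real.cos θ := rfl
@[simp] lemma polarPoint_one (ε s r θ : ℝ) :
    polarPoint ε s r θ 1 = s * (ε + r * Real.sin θ) := rfl

lemma continuous_mk : Continuous (fun p : ℝ × ℝ => (!₂[p.1, p.2] : Plane)) := by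
  refine (PiLp.continuous_toLp 2 _).comp (continuous_pi fun i => ?_)
  fin_cases i
  · exact continuous_fst
  · exact continuous_snd

lemma continuous_polarPoint (ε s : ℝ) :
    Continuous (fun p : ℝ × ℝ => polarPoint ε s p.1 p.2) :=
  continuous_mk.comp (f := fun p : ℝ × ℝ => (p.1 * Real.cos p.2, s * (ε + p.1 * Real.sin p.2)))
    (by fun_prop)

lemma mem_halfDisc {ε ρ s : ℝ} (hρ : 0 < ρ) (x : Plane) :
    x ∈ halfDisc ε ρ 0 s ↔ x 0 ^ 2 + (x 1 - s * ε) ^ 2 < (ρ / 2) ^ 2 ∧ ε < s * x 1 := by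
  simp only [halfDisc, halfPlane, Set.mem_inter_iff, Metric.mem_ball, Set.mem_ofPred_eq,
    EuclideanSpace.dist_eq, Fin.sum_univ_two]
  rw [Real.sqrt_lt' (by positivity)]
  simp [Real.dist_eq, sq_abs]

lemma mem_passage {ε ρ d : ℝ} (x : Plane) :
    x ∈ passage ε ρ d 0 ↔ |x 0| < d ∧ |x 1| < ε := by
  simp [passage]

/-- A reflection and a shift carry the half-plane above the axis to `halfPlane ε s`. -/
lemma measurePreserving_side (ε : ℝ) {s : ℝ} (hs : s = 1 ∨ s = -1) :
    MeasurePreserving (fun p : ℝ × ℝ => (!₂[p.1, s * (ε + p.2)] : Plane)) := by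
  have h : MeasurePreserving (fun y : ℝ => s * (ε + y)) := by
    rcases hs with rfl | rfl
    · simpa using measurePreserving_add_left volume ε
    · have e : (fun y : ℝ => -1 * (ε + y)) = Neg.neg ∘ fun y => ε + y :=
        funext fun y => neg_one_mul (ε + y)
      rw [e]
      exact (Measure.measurePreserving_neg volume).comp (measurePreserving_add_left volume ε)
  exact measurePreserving_mk.comp ((MeasurePreserving.id _).prod h)

lemma measurableEmbedding_side (ε : ℝ) {s : ℝ} (hs : s = 1 ∨ s = -1) :
    MeasurableEmbedding (fun p : ℝ × ℝ => (!₂[p.1, s * (ε + p.2)] : Plane)) := by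
  refine measurableEmbedding_of_injective (continuous_mk.comp
    (f := fun p : ℝ × ℝ => (p.1, s * (ε + p.2))) (by fun_prop)) fun p q h => ?_
  have h0 := congrArg (fun x : Plane => x 0) h
  have h1 := congrArg (fun x : Plane => x 1) h
  simp only [Matrix.cons_val_zero, Matrix.cons_val_one] at h0 h1
  have hs0 : s ≠ 0 := by rcases hs with rfl | rfl <;> norm_num
  exact Prod.ext h0 (by simpa using mul_left_cancel₀ hs0 h1)

lemma setIntegral_rect_eq_interval {a b c e : ℝ} (hab : a ≤ b) (hce : c ≤ e) {f : ℝ → ℝ → ℝ}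
    (hf : Continuous (Function.uncurry f)) :
    ∫ p in Set.Ioo a b ×ˢ Set.Ioo c e, f p.1 p.2 = ∫ x in a..b, ∫ y in c..e, f x y := by
  have hint : IntegrableOn (Function.uncurry f) (Set.Ioo a b ×ˢ Set.Ioo c e)
      ((volume : Measure ℝ).prod volume) :=
    (hf.continuousOn.integrableOn_compact (isCompact_Icc.prod isCompact_Icc)).mono_set
      (Set.prod_mono Set.Ioo_subset_Icc_self Set.Ioo_subset_Icc_self)
  have := setIntegral_prod (Function.uncurry f) hint
  simp only [Function.uncurry] at this
  rw [Measure.volume_eq_prod, this, intervalIntegral.integral_of_le hab,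
    integral_Ioc_eq_integral_Ioo]
  simp only [intervalIntegral.integral_of_le hce, integral_Ioc_eq_integral_Ioo]

lemma interval_swap {a b c e : ℝ} (hab : a ≤ b) (hce : c ≤ e) {f : ℝ → ℝ → ℝ}
    (hf : Continuous (Function.uncurry f)) :
    ∫ x in a..b, ∫ y in c..e, f x y = ∫ y in c..e, ∫ x in a..b, f x y := by
  simp only [intervalIntegral.integral_of_le hab, intervalIntegral.integral_of_le hce]
  refine integral_integral_swap ?_
  rw [Measure.prod_restrict]
  exact (hf.continuousOn.integrableOn_compact (isCompact_Icc.prod isCompact_Icc)).mono_set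
      (Set.prod_mono Set.Ioc_subset_Icc_self Set.Ioc_subset_Icc_self)

/-- Polar coordinates on a half-disc. -/
lemma setIntegral_halfDisc {ε ρ s : ℝ} (hs : s = 1 ∨ s = -1) (hρ : 0 < ρ) {f : Plane → ℝ}
    (hf : Continuous f) :
    ∫ x in halfDisc ε ρ 0 s, f x =
      ∫ r in (0)..ρ / 2, ∫ θ in (0)..Real.pi, r * f (polarPoint ε s r θ) := by
  rw [← setIntegral_rect_eq_interval (f := fun r θ => r * f (polarPoint ε s r θ))
    (by positivity) Real.pi_pos.le
    (continuous_fst.mul (hf.comp (continuous_polarPoint ε s)))]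
  rw [← (measurePreserving_side ε hs).setIntegral_preimage_emb (measurableEmbedding_side ε hs)]
  have hmeas : MeasurableSet (halfDisc ε ρ 0 s) := by
    refine measurableSet_ball.inter (IsOpen.measurableSet ?_)
    exact isOpen_lt continuous_const (by fun_prop)
  rw [← integral_indicator ((measurableEmbedding_side ε hs).measurable hmeas),
    ← integral_comp_polarCoord_symm,
    ← integral_indicator polarCoord.open_target.measurableSet,
    ← integral_indicator (measurableSet_Ioo.prod measurableSet_Ioo)]
  congr 1
  ext ⟨r, θ⟩
  have hss : s * s = 1 := by rcases hs with rfl | rfl <;> norm_num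
  have key : (r, θ) ∈ polarCoord.target →
      ((polarCoord.symm (r, θ) ∈ (fun p : ℝ × ℝ => (!₂[p.1, s * (ε + p.2)] : Plane)) ⁻¹'
        halfDisc ε ρ 0 s) ↔ (r, θ) ∈ Set.Ioo 0 (ρ / 2) ×ˢ Set.Ioo 0 Real.pi) := by
    intro h
    simp only [polarCoord_target, Set.mem_prod, Set.mem_Ioi, Set.mem_Ioo] at h
    obtain ⟨hr, h1, h2⟩ := h
    simp only [Set.mem_preimage, mem_halfDisc hρ, polarCoord_symm_apply, Set.mem_prod, Set.mem_Ioo]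
    simp only [Matrix.cons_val_zero, Matrix.cons_val_one]
    have e1 : (r * Real.cos θ) ^ 2 + (s * (ε + r * Real.sin θ) - s * ε) ^ 2 = r ^ 2 := by
      have : (s * (ε + r * Real.sin θ) - s * ε) ^ 2 = (s * s) * (r * Real.sin θ) ^ 2 := by ring
      rw [this, hss]; nlinarith [Real.sin_sq_add_cos_sq θ]
    have e2 : s * (s * (ε + r * Real.sin θ)) = ε + r * Real.sin θ := by
      rw [← mul_assoc, hss, one_mul]
    rw [e1, e2, sq_lt_sq₀ hr.le (by positivity)]
    constructor
    · rintro ⟨h3, h4⟩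
      refine ⟨⟨hr, h3⟩, ?_, h2⟩
      by_contra h5
      have := Real.sin_nonpos_of_nonpos_of_neg_pi_le (not_lt.1 h5) h1.le
      nlinarith
    · rintro ⟨⟨_, h3⟩, h4, h5⟩
      exact ⟨h3, by have := Real.sin_pos_of_pos_of_lt_pi h4 h5; nlinarith⟩
  by_cases hT : (r, θ) ∈ polarCoord.target
  · rw [Set.indicator_of_mem hT]
    by_cases hI : (r, θ) ∈ Set.Ioo 0 (ρ / 2) ×ˢ Set.Ioo 0 Real.pi
    · rw [Set.indicator_of_mem hI, Set.indicator_of_mem ((key hT).2 hI)]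
      simp [polarPoint]
    · rw [Set.indicator_of_notMem hI, Set.indicator_of_notMem (mt (key hT).1 hI), smul_zero]
  · rw [Set.indicator_of_notMem hT, Set.indicator_of_notMem]
    rintro ⟨⟨h1, h2⟩, h3, h4⟩
    refine hT ⟨h1, ?_, h4⟩
    simp only at *
    linarith

lemma setIntegral_passage {ε ρ d : ℝ} (hε : 0 < ε) (hd : 0 < d) {f : Plane → ℝ}
    (hf : Continuous f) :
    ∫ x in passage ε ρ d 0, f x = ∫ x in (-d)..d, ∫ y in (-ε)..ε, f !₂[x, y] := by
  rw [← setIntegral_rect_eq_interval (f := fun x y => f !₂[x, y])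
    (by linarith) (by linarith) (hf.comp continuous_mk)]
  have he : MeasurableEmbedding (fun p : ℝ × ℝ => (!₂[p.1, p.2] : Plane)) := by
    simpa using measurableEmbedding_side 0 (Or.inl rfl)
  rw [← measurePreserving_mk.setIntegral_preimage_emb he]
  congr 2
  ext ⟨x, y⟩
  simp [mem_passage, abs_lt]

lemma convex_halfPlane (ε s : ℝ) : Convex ℝ (halfPlane ε s) := by
  have h : IsLinearMap ℝ (fun x : Plane => s * x 1) :=
    ⟨fun x y => by simp [mul_add], fun c x => by simp; ring⟩
  exact convex_halfSpace_gt h ε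

lemma convex_halfDisc (ε ρ : ℝ) (k : ℤ) (s : ℝ) : Convex ℝ (halfDisc ε ρ k s) :=
  (convex_ball _ _).inter (convex_halfPlane ε s)

lemma convex_passage (ε ρ d : ℝ) : Convex ℝ (passage ε ρ d 0) := by
  have h (i : Fin 2) : IsLinearMap ℝ (fun x : Plane => x i) :=
    ⟨fun x y => rfl, fun c x => rfl⟩
  have : passage ε ρ d 0 = ({x | -d < x 0} ∩ {x | x 0 < d}) ∩ ({x | -ε < x 1} ∩ {x | x 1 < ε}) := by
    ext x; simp [mem_passage, abs_lt]
  rw [this]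
  exact ((convex_halfSpace_gt (h 0) _).inter (convex_halfSpace_lt (h 0) _)).inter
    ((convex_halfSpace_gt (h 1) _).inter (convex_halfSpace_lt (h 1) _))

lemma isOpen_halfDisc (ε ρ : ℝ) (k : ℤ) (s : ℝ) : IsOpen (halfDisc ε ρ k s) :=
  Metric.isOpen_ball.inter (isOpen_lt continuous_const (by fun_prop))

lemma isOpen_passage (ε ρ d : ℝ) : IsOpen (passage ε ρ d 0) :=
  (isOpen_lt (f := fun x : Plane => |x 0 - ρ * (0 : ℤ)|) (by fun_prop) continuous_const).inter
    (isOpen_lt (f := fun x : Plane => |x 1|) (by fun_prop) continuous_const)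

/-- Closing up and taking the interior changes the three convex pieces by a null set only. -/
lemma cell_ae_eq (ε ρ d : ℝ) :
    cell ε ρ d 0 =ᵐ[volume]
      (passage ε ρ d 0 ∪ halfDisc ε ρ 0 1 ∪ halfDisc ε ρ 0 (-1) : Set Plane) := by
  have hcl {A : Set Plane} (hA : Convex ℝ A) : (closure A : Set Plane) =ᵐ[volume] A :=
    closure_ae_eq_of_null_frontier (hA.addHaar_frontier volume)
  have h1 := ((hcl (convex_passage ε ρ d)).union (hcl (convex_halfDisc ε ρ 0 1))).union
    (hcl (convex_halfDisc ε ρ 0 (-1)))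
  rw [← closure_union, ← closure_union] at h1
  refine EventuallyLE.antisymm ?_ ?_
  · exact (LE.le.eventuallyLE interior_subset).trans h1.le
  · refine LE.le.eventuallyLE (interior_maximal subset_closure ?_)
    exact ((isOpen_passage ε ρ d).union (isOpen_halfDisc _ _ _ _)).union (isOpen_halfDisc _ _ _ _)

lemma isBounded_cell (ε ρ d : ℝ) : Bornology.IsBounded (cell ε ρ d 0) := by
  have hB (s : ℝ) : Bornology.IsBounded (halfDisc ε ρ 0 s) :=
    Metric.isBounded_ball.subset Set.inter_subset_left
  have hP : Bornology.IsBounded (passage ε ρ d 0) := by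
    refine (Metric.isBounded_ball (x := (0 : Plane)) (r := |d| + |ε| + 1)).subset fun x hx => ?_
    rw [mem_passage] at hx
    rw [mem_ball_zero_iff, EuclideanSpace.norm_eq, Real.sqrt_lt' (by positivity)]
    simp only [Fin.sum_univ_two, Real.norm_eq_abs]
    have h1 := hx.1.trans_le (le_abs_self d)
    have h2 := hx.2.trans_le (le_abs_self ε)
    nlinarith [abs_nonneg (x 0), abs_nonneg (x 1)]
  exact ((hP.union (hB 1)).union (hB (-1))).closure.subset interior_subset

/-- The integral of a continuous function over the cell, piece by piece. -/
lemma setIntegral_cell {ε ρ d : ℝ} (hε : 0 < ε) (hρ : 0 < ρ) (hd : 0 < d) {f : Plane → ℝ}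
    (hf : Continuous f) :
    ∫ x in cell ε ρ d 0, f x =
      (∫ x in (-d)..d, ∫ y in (-ε)..ε, f !₂[x, y])
      + (∫ r in (0)..ρ / 2, ∫ θ in (0)..Real.pi, r * f (polarPoint ε 1 r θ))
      + ∫ r in (0)..ρ / 2, ∫ θ in (0)..Real.pi, r * f (polarPoint ε (-1) r θ) := by
  have hint : IntegrableOn f (cell ε ρ d 0) :=
    (hf.continuousOn.integrableOn_compact (isBounded_cell ε ρ d).isCompact_closure).mono_set
      subset_closure
  have hint' := hint.congr_set_ae (cell_ae_eq ε ρ d).symm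
  rw [setIntegral_congr_set (cell_ae_eq ε ρ d), setIntegral_union, setIntegral_union,
    setIntegral_passage hε hd hf, setIntegral_halfDisc (Or.inl rfl) hρ hf,
    setIntegral_halfDisc (Or.inr rfl) hρ hf]
  · refine Set.disjoint_left.2 fun x h1 h2 => ?_
    rw [mem_passage, abs_lt, abs_lt] at h1
    rw [mem_halfDisc hρ] at h2
    linarith [h1.2.2, h2.2]
  · exact (isOpen_halfDisc _ _ _ _).measurableSet
  · exact hint'.mono_set (Set.subset_union_left.trans Set.subset_union_left)
  · exact hint'.mono_set (Set.subset_union_right.trans Set.subset_union_left)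
  · refine Set.disjoint_left.2 fun x h1 h2 => ?_
    rw [Set.mem_union, mem_passage, abs_lt, abs_lt, mem_halfDisc hρ] at h1
    rw [mem_halfDisc hρ] at h2
    rcases h1 with h1 | h1
    · linarith [h1.2.1, h2.2]
    · linarith [h1.2, h2.2]
  · exact (isOpen_halfDisc _ _ _ _).measurableSet
  · exact hint'.mono_set Set.subset_union_left
  · exact hint'.mono_set Set.subset_union_right

/-! ### One-dimensional estimates -/

lemma continuous_const_mul_fun {g : ℝ → ℝ} (c : ℝ) (hg : Continuous g) :
    Continuous fun x => c * g x := continuous_const.mul hg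

lemma abs_sub_le_integral {F F' n : ℝ → ℝ} (hF : ∀ x, HasDerivAt F (F' x) x)
    (hF' : Continuous F') (hn : Continuous n) {a b : ℝ} (hab : a ≤ b)
    (hle : ∀ x ∈ Set.Icc a b, |F' x| ≤ n x) : |F b - F a| ≤ ∫ x in a..b, n x := by
  rw [← intervalIntegral.integral_eq_sub_of_hasDerivAt (fun x _ => hF x)
    (hF'.intervalIntegrable a b)]
  refine (intervalIntegral.abs_integral_le_integral_abs hab).trans ?_
  exact intervalIntegral.integral_mono_on hab (hF'.abs.intervalIntegrable _ _)
    (hn.intervalIntegrable _ _) hle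

/-- Comparison of an end value with the mean over an initial interval; on that interval an
integration by parts puts the weight `r` on the derivative. -/
lemma abs_sub_mean_le {F F' n : ℝ → ℝ} (hF : ∀ x, HasDerivAt F (F' x) x)
    (hF' : Continuous F') (hn : Continuous n) (hle : ∀ x, |F' x| ≤ n x) {d R : ℝ}
    (hd : 0 < d) (hdR : d ≤ R) :
    |F R - (1 / d) * ∫ r in (0)..d, F r| ≤
      (∫ r in d..R, n r) + (1 / d) * ∫ r in (0)..d, r * n r := by
  have hparts : ∫ r in (0)..d, r * F' r = d * F d - ∫ r in (0)..d, F r := by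
    have := intervalIntegral.integral_mul_deriv_eq_deriv_mul (a := 0) (b := d)
      (u := fun r => r) (u' := fun _ => 1) (v := F) (v' := F') (fun x _ => hasDerivAt_id x)
      (fun x _ => hF x) (by simp) (hF'.intervalIntegrable _ _)
    simpa using this
  have h1 := abs_sub_le_integral hF hF' hn hdR fun x _ => hle x
  have h2 : |∫ r in (0)..d, r * F' r| ≤ ∫ r in (0)..d, r * n r := by
    refine (intervalIntegral.abs_integral_le_integral_abs hd.le).trans ?_
    refine intervalIntegral.integral_mono_on hd.le
      ((continuous_id.mul hF').abs.intervalIntegrable _ _)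
      ((continuous_id.mul hn).intervalIntegrable _ _) fun x hx => ?_
    rw [abs_mul, abs_of_nonneg hx.1]
    exact mul_le_mul_of_nonneg_left (hle x) hx.1
  have h3 : F R - (1 / d) * ∫ r in (0)..d, F r =
      (F R - F d) + (1 / d) * ∫ r in (0)..d, r * F' r := by
    rw [hparts]; field_simp; ring
  rw [h3]
  refine (abs_add_le _ _).trans (add_le_add h1 ?_)
  rw [abs_mul, abs_of_pos (by positivity)]
  exact mul_le_mul_of_nonneg_left h2 (by positivity)

/-- Comparison of the mean over an interval with the average of the two end values. -/
lemma abs_mean_sub_ends_le {F F' n : ℝ → ℝ} (hF : ∀ x, HasDerivAt F (F' x) x)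
    (hF' : Continuous F') (hn : Continuous n) {b : ℝ} (hb : 0 < b)
    (hle : ∀ x ∈ Set.Icc 0 b, |F' x| ≤ n x) :
    |(1 / b) * (∫ θ in (0)..b, F θ) - (F 0 + F b) / 2| ≤ (1 / 2) * ∫ θ in (0)..b, n θ := by
  have hFc : Continuous F := continuous_iff_continuousAt.2 fun x => (hF x).continuousAt
  have hpt : ∀ θ ∈ Set.Icc 0 b, |F θ - (F 0 + F b) / 2| ≤ (1 / 2) * ∫ θ in (0)..b, n θ := by
    intro θ hθ
    have h1 := abs_sub_le_integral hF hF' hn hθ.1 fun x hx => hle x ⟨hx.1, hx.2.trans hθ.2⟩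
    have h2 := abs_sub_le_integral hF hF' hn hθ.2 fun x hx => hle x ⟨hθ.1.trans hx.1, hx.2⟩
    rw [← intervalIntegral.integral_add_adjacent_intervals (hn.intervalIntegrable 0 θ)
      (hn.intervalIntegrable θ b)]
    rw [abs_le] at *
    constructor <;> linarith
  have h := intervalIntegral.norm_integral_le_of_norm_le_const (a := 0) (b := b)
    (f := fun θ => F θ - (F 0 + F b) / 2) (C := (1 / 2) * ∫ θ in (0)..b, n θ) (by
      intro θ hθ
      rw [Set.uIoc_of_le hb.le] at hθ
      exact hpt θ ⟨hθ.1.le, hθ.2⟩)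
  rw [intervalIntegral.integral_sub (hFc.intervalIntegrable _ _) (by simp),
    intervalIntegral.integral_const, Real.norm_eq_abs, sub_zero, abs_of_pos hb, smul_eq_mul] at h
  have e : (1 / b) * (∫ θ in (0)..b, F θ) - (F 0 + F b) / 2 =
      (1 / b) * ((∫ θ in (0)..b, F θ) - b * ((F 0 + F b) / 2)) := by field_simp
  rw [e, abs_mul, abs_of_pos (by positivity), one_div, inv_mul_le_iff₀ hb]
  linarith

lemma mul_le_young {a b l : ℝ} (hl : 0 < l) : a * b ≤ (l * a ^ 2 + b ^ 2 / l) / 2 := by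
  have : 0 ≤ (l * a - b) ^ 2 / l := by positivity
  have e : (l * a - b) ^ 2 / l = l * a ^ 2 + b ^ 2 / l - 2 * (a * b) := by field_simp; ring
  linarith

/-! ### The resistance of a half-disc -/

section HalfDisc

variable {f fr ft n : ℝ → ℝ → ℝ} {d R : ℝ}

/-- The mean of `f` over the half-circle of radius `R` minus its mean over the interval of
half-length `d` on the axis, bounded by weighted integrals of the length `n` of the gradient.
The interval is the union of the rays `θ = 0` and `θ = π`, so that the two means are compared
through the mean over the half-disc of radius `d`, taken with the measure `dr dθ`. -/
lemma half_estimate_aux (hf : Continuous (Function.uncurry f))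
    (hfr : Continuous (Function.uncurry fr)) (hft : Continuous (Function.uncurry ft))
    (hn : Continuous (Function.uncurry n))
    (hr : ∀ r θ, HasDerivAt (fun r => f r θ) (fr r θ) r)
    (ht : ∀ r θ, HasDerivAt (f r) (ft r θ) θ)
    (hrn : ∀ r θ, |fr r θ| ≤ n r θ) (htn : ∀ r θ, 0 ≤ r → |ft r θ| ≤ r * n r θ)
    (hd : 0 < d) (hdR : d ≤ R) :
    |(1 / Real.pi) * (∫ θ in (0)..Real.pi, f R θ)
        - (1 / d) * ∫ r in (0)..d, (f r 0 + f r Real.pi) / 2| ≤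
      (1 / Real.pi) * (∫ r in d..R, ∫ θ in (0)..Real.pi, n r θ) +
      (1 / Real.pi + 1 / 2) * (1 / d) * ∫ r in (0)..d, ∫ θ in (0)..Real.pi, r * n r θ := by
  have hπ := Real.pi_pos
  have hrn' : Continuous (Function.uncurry fun r θ => r * n r θ) := continuous_fst.mul hn
  have hswap {h : ℝ → ℝ → ℝ} (hh : Continuous (Function.uncurry h)) :
      Continuous (Function.uncurry fun θ r => h r θ) := hh.comp continuous_swap
  have cθ {h : ℝ → ℝ → ℝ} (hh : Continuous (Function.uncurry h)) (a b : ℝ) :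
      Continuous fun r => ∫ θ in a..b, h r θ :=
    intervalIntegral.continuous_parametric_intervalIntegral_of_continuous' hh a b
  have s1 (r : ℝ) : Continuous (f r) := hf.comp (by fun_prop : Continuous fun θ : ℝ => (r, θ))
  have s2 (θ : ℝ) : Continuous (fun r => f r θ) :=
    hf.comp (by fun_prop : Continuous fun r : ℝ => (r, θ))
  have b1 (θ : ℝ) := abs_sub_mean_le (fun r => hr r θ)
    (hfr.comp (by fun_prop : Continuous fun r : ℝ => (r, θ)))
    (hn.comp (by fun_prop : Continuous fun r : ℝ => (r, θ))) (fun r => hrn r θ) hd hdR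
  have b2 (r : ℝ) (h0 : 0 ≤ r) := abs_mean_sub_ends_le (fun θ => ht r θ)
    (hft.comp (by fun_prop : Continuous fun θ : ℝ => (r, θ)))
    (hrn'.comp (by fun_prop : Continuous fun θ : ℝ => (r, θ))) hπ (fun θ _ => htn r θ h0)
  simp only [Function.comp_def, Function.uncurry] at b1 b2
  have c1 : Continuous fun θ => f R θ - (1 / d) * ∫ r in (0)..d, f r θ :=
    (s1 R).sub (continuous_const_mul_fun _ (cθ (hswap hf) 0 d))
  have c3 : Continuous fun r => (f r 0 + f r Real.pi) / 2 := ((s2 0).add (s2 _)).div_const 2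
  have c2 : Continuous fun r => (1 / Real.pi) * (∫ θ in (0)..Real.pi, f r θ)
      - (f r 0 + f r Real.pi) / 2 :=
    (continuous_const_mul_fun _ (cθ hf 0 _)).sub c3
  have e : (1 / Real.pi) * (∫ θ in (0)..Real.pi, f R θ)
        - (1 / d) * ∫ r in (0)..d, (f r 0 + f r Real.pi) / 2 =
      (1 / Real.pi) * (∫ θ in (0)..Real.pi, (f R θ - (1 / d) * ∫ r in (0)..d, f r θ)) +
      (1 / d) * ∫ r in (0)..d, ((1 / Real.pi) * (∫ θ in (0)..Real.pi, f r θ)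
      - (f r 0 + f r Real.pi) / 2) := by
    rw [intervalIntegral.integral_sub ((s1 R).intervalIntegrable _ _)
        ((continuous_const_mul_fun _ (cθ (hswap hf) 0 d)).intervalIntegrable _ _),
      intervalIntegral.integral_sub
        ((continuous_const_mul_fun _ (cθ hf 0 _)).intervalIntegrable _ _)
        (c3.intervalIntegrable _ _),
      intervalIntegral.integral_const_mul, intervalIntegral.integral_const_mul,
      interval_swap hd.le hπ.le hf]
    ring
  rw [e]
  refine (abs_add_le _ _).trans ?_
  rw [abs_mul, abs_mul, abs_of_pos (by positivity : 0 < 1 / Real.pi),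
    abs_of_pos (by positivity : 0 < 1 / d)]
  have i1 : |∫ θ in (0)..Real.pi, (f R θ - (1 / d) * ∫ r in (0)..d, f r θ)| ≤
      (∫ r in d..R, ∫ θ in (0)..Real.pi, n r θ) +
      (1 / d) * ∫ r in (0)..d, ∫ θ in (0)..Real.pi, r * n r θ := by
    refine (intervalIntegral.abs_integral_le_integral_abs hπ.le).trans ?_
    rw [interval_swap hdR hπ.le hn, interval_swap hd.le hπ.le hrn',
      ← intervalIntegral.integral_const_mul, ← intervalIntegral.integral_add
        ((cθ (hswap hn) _ _).intervalIntegrable _ _)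
        ((continuous_const_mul_fun _ (cθ (hswap hrn') _ _)).intervalIntegrable _ _)]
    exact intervalIntegral.integral_mono_on hπ.le (c1.abs.intervalIntegrable _ _)
      (((cθ (hswap hn) _ _).add
        (continuous_const_mul_fun _ (cθ (hswap hrn') _ _))).intervalIntegrable _ _) fun θ _ => b1 θ
  have i2 : |∫ r in (0)..d, ((1 / Real.pi) * (∫ θ in (0)..Real.pi, f r θ)
      - (f r 0 + f r Real.pi) / 2)| ≤
      (1 / 2) * ∫ r in (0)..d, ∫ θ in (0)..Real.pi, r * n r θ := by
    refine (intervalIntegral.abs_integral_le_integral_abs hd.le).trans ?_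
    rw [← intervalIntegral.integral_const_mul]
    exact intervalIntegral.integral_mono_on hd.le (c2.abs.intervalIntegrable _ _)
      ((continuous_const_mul_fun _ (cθ hrn' _ _)).intervalIntegrable _ _) fun r hr => b2 r hr.1
  calc _ ≤ (1 / Real.pi) * ((∫ r in d..R, ∫ θ in (0)..Real.pi, n r θ) +
      (1 / d) * ∫ r in (0)..d, ∫ θ in (0)..Real.pi, r * n r θ) +
      (1 / d) * ((1 / 2) * ∫ r in (0)..d, ∫ θ in (0)..Real.pi, r * n r θ) := by gcongr
    _ = _ := by ring

/-- The bound of `half_estimate_aux` in terms of the energy. The Young inequality is applied with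
the weight `1 / (π r)` of a radial unit flux for `r ≥ d` and with the weight `1 / d` for `r ≤ d`. -/
lemma half_estimate (hf : Continuous (Function.uncurry f))
    (hfr : Continuous (Function.uncurry fr)) (hft : Continuous (Function.uncurry ft))
    (hn : Continuous (Function.uncurry n))
    (hr : ∀ r θ, HasDerivAt (fun r => f r θ) (fr r θ) r)
    (ht : ∀ r θ, HasDerivAt (f r) (ft r θ) θ)
    (hrn : ∀ r θ, |fr r θ| ≤ n r θ) (htn : ∀ r θ, 0 ≤ r → |ft r θ| ≤ r * n r θ)
    (hd : 0 < d) (hdR : d ≤ R) {l : ℝ} (hl : 0 < l) :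
    |(1 / Real.pi) * (∫ θ in (0)..Real.pi, f R θ)
        - (1 / d) * ∫ r in (0)..d, (f r 0 + f r Real.pi) / 2| ≤
      (l * (Real.log (R / d) / Real.pi + Real.pi / 2) +
        (∫ r in (0)..R, ∫ θ in (0)..Real.pi, r * n r θ ^ 2) / l) / 2 := by
  have hπ := Real.pi_pos
  refine (half_estimate_aux hf hfr hft hn hr ht hrn htn hd hdR).trans ?_
  have hrn' : Continuous (Function.uncurry fun r θ => r * n r θ) := continuous_fst.mul hn
  have hE : Continuous (Function.uncurry fun r θ => r * n r θ ^ 2) := continuous_fst.mul (hn.pow 2)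
  have cθ {h : ℝ → ℝ → ℝ} (hh : Continuous (Function.uncurry h)) (a b : ℝ) :
      Continuous fun r => ∫ θ in a..b, h r θ :=
    intervalIntegral.continuous_parametric_intervalIntegral_of_continuous' hh a b
  have sec {h : ℝ → ℝ → ℝ} (hh : Continuous (Function.uncurry h)) (r : ℝ) : Continuous (h r) :=
    hh.comp (by fun_prop : Continuous fun θ : ℝ => (r, θ))
  have iinv : IntervalIntegrable (fun r : ℝ => r⁻¹) volume d R := by
    refine ContinuousOn.intervalIntegrable_of_Icc hdR fun x hx => ?_
    exact (continuousAt_inv₀ (hd.trans_le hx.1).ne').continuousWithinAt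
  have far : (1 / Real.pi) * (∫ r in d..R, ∫ θ in (0)..Real.pi, n r θ) ≤
      (l * (Real.log (R / d) / Real.pi) +
        (∫ r in d..R, ∫ θ in (0)..Real.pi, r * n r θ ^ 2) / l) / 2 := by
    have hlog : (l * (Real.log (R / d) / Real.pi) +
        (∫ r in d..R, ∫ θ in (0)..Real.pi, r * n r θ ^ 2) / l) / 2 =
        ∫ r in d..R, (l / (2 * Real.pi) * r⁻¹ +
          (1 / (2 * l)) * ∫ θ in (0)..Real.pi, r * n r θ ^ 2) := by
      rw [intervalIntegral.integral_add (iinv.const_mul _)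
        ((continuous_const_mul_fun _ (cθ hE _ _)).intervalIntegrable _ _),
        intervalIntegral.integral_const_mul, intervalIntegral.integral_const_mul,
        integral_inv_of_pos hd (hd.trans_le hdR)]
      field_simp
    rw [hlog, ← intervalIntegral.integral_const_mul]
    refine intervalIntegral.integral_mono_on hdR
      ((continuous_const_mul_fun _ (cθ hn _ _)).intervalIntegrable _ _)
      ((iinv.const_mul _).add ((continuous_const_mul_fun _ (cθ hE _ _)).intervalIntegrable _ _))
      fun r hr' => ?_
    have r0 : 0 < r := hd.trans_le hr'.1
    have : l / (2 * Real.pi) * r⁻¹ + (1 / (2 * l)) * ∫ θ in (0)..Real.pi, r * n r θ ^ 2 =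
        ∫ θ in (0)..Real.pi, (l / (2 * Real.pi ^ 2 * r) + (1 / (2 * l)) * (r * n r θ ^ 2)) := by
      rw [intervalIntegral.integral_add intervalIntegrable_const
        ((continuous_const_mul_fun _ (sec hE r)).intervalIntegrable _ _),
        intervalIntegral.integral_const_mul (1 / (2 * l)), intervalIntegral.integral_const]
      simp only [smul_eq_mul, sub_zero]
      field_simp
    rw [this, ← intervalIntegral.integral_const_mul]
    refine intervalIntegral.integral_mono_on hπ.le
      ((continuous_const_mul_fun _ (sec hn r)).intervalIntegrable _ _)
      ((continuous_const.add (continuous_const_mul_fun _ (sec hE r))).intervalIntegrable _ _)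
      fun θ _ => ?_
    have y := mul_le_young (a := 1 / (Real.pi * r)) (b := n r θ) hl
    have := mul_le_mul_of_nonneg_left y r0.le
    calc _ = r * (1 / (Real.pi * r) * n r θ) := by field_simp
      _ ≤ r * ((l * (1 / (Real.pi * r)) ^ 2 + n r θ ^ 2 / l) / 2) := this
      _ = _ := by field_simp
  have near : (1 / Real.pi + 1 / 2) * (1 / d) * (∫ r in (0)..d, ∫ θ in (0)..Real.pi, r * n r θ) ≤
      (l * (Real.pi / 2) +
        (∫ r in (0)..d, ∫ θ in (0)..Real.pi, r * n r θ ^ 2) / l) / 2 := by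
    have e : (l * (Real.pi / 2) +
        (∫ r in (0)..d, ∫ θ in (0)..Real.pi, r * n r θ ^ 2) / l) / 2 =
        ∫ r in (0)..d, (l * Real.pi / (2 * d ^ 2) * r +
          (1 / (2 * l)) * ∫ θ in (0)..Real.pi, r * n r θ ^ 2) := by
      rw [intervalIntegral.integral_add
        ((continuous_const_mul_fun _ continuous_id').intervalIntegrable _ _)
        ((continuous_const_mul_fun _ (cθ hE _ _)).intervalIntegrable _ _),
        intervalIntegral.integral_const_mul, intervalIntegral.integral_const_mul, integral_id]
      field_simp
      ring
    rw [e, ← intervalIntegral.integral_const_mul]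
    refine intervalIntegral.integral_mono_on hd.le
      ((continuous_const_mul_fun _ (cθ hrn' _ _)).intervalIntegrable _ _)
      (((continuous_const_mul_fun _ continuous_id').add
        (continuous_const_mul_fun _ (cθ hE _ _))).intervalIntegrable _ _)
      fun r hr' => ?_
    have : l * Real.pi / (2 * d ^ 2) * r + (1 / (2 * l)) * ∫ θ in (0)..Real.pi, r * n r θ ^ 2 =
        ∫ θ in (0)..Real.pi, (l / (2 * d ^ 2) * r + (1 / (2 * l)) * (r * n r θ ^ 2)) := by
      rw [intervalIntegral.integral_add intervalIntegrable_const
        ((continuous_const_mul_fun _ (sec hE r)).intervalIntegrable _ _),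
        intervalIntegral.integral_const_mul (1 / (2 * l)), intervalIntegral.integral_const]
      simp only [smul_eq_mul, sub_zero]
      ring
    rw [this, ← intervalIntegral.integral_const_mul]
    refine intervalIntegral.integral_mono_on hπ.le
      ((continuous_const_mul_fun _ (sec hrn' r)).intervalIntegrable _ _)
      ((continuous_const.add (continuous_const_mul_fun _ (sec hE r))).intervalIntegrable _ _)
      fun θ _ => ?_
    have y := mul_le_young (a := 1 / d) (b := n r θ) hl
    have y' := mul_le_mul_of_nonneg_left y hr'.1
    have hc : 1 / Real.pi + 1 / 2 ≤ 1 := by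
      have : 1 / Real.pi ≤ 1 / 2 := one_div_le_one_div_of_le (by norm_num) Real.two_le_pi
      linarith
    have hn0 : 0 ≤ n r θ := (abs_nonneg _).trans (hrn r θ)
    have h0 : 0 ≤ r * (1 / d * n r θ) :=
      mul_nonneg hr'.1 (mul_nonneg (by positivity) hn0)
    calc _ = (1 / Real.pi + 1 / 2) * (r * (1 / d * n r θ)) := by ring
      _ ≤ r * (1 / d * n r θ) := mul_le_of_le_one_left h0 hc
      _ ≤ r * ((l * (1 / d) ^ 2 + n r θ ^ 2 / l) / 2) := y'
      _ = _ := by field_simp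
  rw [← intervalIntegral.integral_add_adjacent_intervals ((cθ hE 0 Real.pi).intervalIntegrable 0 d)
    ((cθ hE 0 Real.pi).intervalIntegrable d R)]
  refine (add_le_add far near).trans (le_of_eq ?_)
  field_simp
  ring

end HalfDisc

/-! ### The flux estimate for smooth functions -/

lemma continuous_gradient {φ : Plane → ℝ} (hφ : ContDiff ℝ 1 φ) : Continuous (gradient φ) :=
  (InnerProductSpace.toDual ℝ Plane).symm.continuous.comp (hφ.continuous_fderiv one_ne_zero)

lemma abs_fderiv_le (φ : Plane → ℝ) (x v : Plane) : |fderiv ℝ φ x v| ≤ ‖gradient φ x‖ * ‖v‖ := by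
  rw [← inner_gradient_left]
  exact abs_real_inner_le_norm _ _

lemma hasDerivAt_mk {a b : ℝ → ℝ} {a' b' t : ℝ} (ha : HasDerivAt a a' t) (hb : HasDerivAt b b' t) :
    HasDerivAt (fun t => (!₂[a t, b t] : Plane)) !₂[a', b'] t := by
  have h : HasDerivAt (fun t => ![a t, b t]) ![a', b'] t := by
    rw [hasDerivAt_pi]
    intro i
    fin_cases i
    · exact ha
    · exact hb
  exact ((EuclideanSpace.equiv (Fin 2) ℝ).symm :
    (Fin 2 → ℝ) →L[ℝ] Plane).hasFDerivAt.comp_hasDerivAt t h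

lemma norm_mk_sq (a b : ℝ) : ‖(!₂[a, b] : Plane)‖ ^ 2 = a ^ 2 + b ^ 2 := by
  rw [EuclideanSpace.norm_sq_eq]
  simp [Fin.sum_univ_two]

lemma norm_mk_eq {a b c : ℝ} (hc : 0 ≤ c) (h : a ^ 2 + b ^ 2 = c ^ 2) : ‖(!₂[a, b] : Plane)‖ = c :=
  (sq_eq_sq₀ (norm_nonneg _) hc).1 ((norm_mk_sq a b).trans h)

/-- The mean of `φ` over the semicircle, taken with respect to the angle. -/
noncomputable def arcMean (ε ρ s : ℝ) (φ : Plane → ℝ) : ℝ :=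
  (1 / Real.pi) * ∫ θ in (0)..Real.pi, φ (polarPoint ε s (ρ / 2) θ)

/-- The mean of `φ` over the end of the passage at the height `h`. -/
noncomputable def mouthMean (d h : ℝ) (φ : Plane → ℝ) : ℝ :=
  (1 / (2 * d)) * ∫ x in (-d)..d, φ !₂[x, h]

lemma abs_arcMean_sub_mouthMean_le {φ : Plane → ℝ} (hφ : ContDiff ℝ 1 φ) {ε ρ d s l : ℝ}
    (hs : s = 1 ∨ s = -1) (hd : 0 < d) (hdρ : d < ρ / 2) (hl : 0 < l) :
    |arcMean ε ρ s φ - mouthMean d (s * ε) φ| ≤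
      (l * (Real.log (ρ / 2 / d) / Real.pi + Real.pi / 2) +
        (∫ r in (0)..ρ / 2, ∫ θ in (0)..Real.pi, r * ‖gradient φ (polarPoint ε s r θ)‖ ^ 2) / l)
          / 2 := by
  have hss : s ^ 2 = 1 := by rcases hs with rfl | rfl <;> norm_num
  have cp := continuous_polarPoint ε s
  have cD : Continuous fun p : ℝ × ℝ => fderiv ℝ φ (polarPoint ε s p.1 p.2) :=
    (hφ.continuous_fderiv one_ne_zero).comp cp
  have hD (x : Plane) : HasFDerivAt φ (fderiv ℝ φ x) x :=
    (hφ.differentiable one_ne_zero x).hasFDerivAt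
  have key := half_estimate (f := fun r θ => φ (polarPoint ε s r θ))
    (fr := fun r θ => fderiv ℝ φ (polarPoint ε s r θ) !₂[Real.cos θ, s * Real.sin θ])
    (ft := fun r θ => fderiv ℝ φ (polarPoint ε s r θ) !₂[-(r * Real.sin θ), s * (r * Real.cos θ)])
    (n := fun r θ => ‖gradient φ (polarPoint ε s r θ)‖) (d := d) (R := ρ / 2)
    (hφ.continuous.comp cp)
    (cD.clm_apply (continuous_mk.comp
      (f := fun p : ℝ × ℝ => (Real.cos p.2, s * Real.sin p.2)) (by fun_prop)))
    (cD.clm_apply (continuous_mk.comp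
      (f := fun p : ℝ × ℝ => (-(p.1 * Real.sin p.2), s * (p.1 * Real.cos p.2))) (by fun_prop)))
    (((continuous_gradient hφ).comp cp).norm)
    (fun r θ => by
      refine (hD _).comp_hasDerivAt r (hasDerivAt_mk ?_ ?_)
      · simpa using (hasDerivAt_id r).mul_const (Real.cos θ)
      · simpa using (((hasDerivAt_id r).mul_const (Real.sin θ)).const_add ε).const_mul s)
    (fun r θ => by
      refine (hD _).comp_hasDerivAt θ (hasDerivAt_mk ?_ ?_)
      · simpa using (Real.hasDerivAt_cos θ).const_mul r
      · simpa using (((Real.hasDerivAt_sin θ).const_mul r).const_add ε).const_mul s)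
    (fun r θ => by
      refine (abs_fderiv_le _ _ _).trans_eq ?_
      rw [norm_mk_eq zero_le_one, mul_one]
      rw [mul_pow, hss]
      linarith [Real.sin_sq_add_cos_sq θ])
    (fun r θ hr => by
      refine (abs_fderiv_le _ _ _).trans_eq ?_
      rw [norm_mk_eq hr, mul_comm]
      linear_combination r ^ 2 * Real.cos θ ^ 2 * hss + r ^ 2 * Real.sin_sq_add_cos_sq θ)
    hd hdρ.le hl
  have cl : Continuous fun x : ℝ => φ !₂[x, s * ε] :=
    hφ.continuous.comp (continuous_mk.comp (f := fun x : ℝ => (x, s * ε)) (by fun_prop))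
  have hm : mouthMean d (s * ε) φ =
      (1 / d) * ∫ r in (0)..d, (φ (polarPoint ε s r 0) + φ (polarPoint ε s r Real.pi)) / 2 := by
    have e : ∀ r, (φ (polarPoint ε s r 0) + φ (polarPoint ε s r Real.pi)) / 2 =
        (1 / 2) * (φ !₂[r, s * ε] + φ !₂[-r, s * ε]) := fun r => by simp [polarPoint]; ring
    have hneg : ∫ r in (0)..d, φ !₂[-r, s * ε] = ∫ x in (-d)..0, φ !₂[x, s * ε] := by
      simpa using intervalIntegral.integral_comp_neg (a := 0) (b := d) fun x => φ !₂[x, s * ε]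
    have cn : Continuous fun x : ℝ => φ !₂[-x, s * ε] := cl.comp continuous_neg
    simp_rw [e]
    rw [intervalIntegral.integral_const_mul,
      intervalIntegral.integral_add (cl.intervalIntegrable _ _) (cn.intervalIntegrable _ _), hneg,
      mouthMean, ← intervalIntegral.integral_add_adjacent_intervals (cl.intervalIntegrable (-d) 0)
        (cl.intervalIntegrable 0 d)]
    field_simp
    ring
  rw [hm]
  exact key

lemma abs_mouthMean_sub_mouthMean_le {φ : Plane → ℝ} (hφ : ContDiff ℝ 1 φ) {ε d l : ℝ}
    (hε : 0 < ε) (hd : 0 < d) (hl : 0 < l) :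
    |mouthMean d ε φ - mouthMean d (-ε) φ| ≤
      (l * (ε / d) + (∫ x in (-d)..d, ∫ y in (-ε)..ε, ‖gradient φ !₂[x, y]‖ ^ 2) / l) / 2 := by
  have hD (x : Plane) : HasFDerivAt φ (fderiv ℝ φ x) x :=
    (hφ.differentiable one_ne_zero x).hasFDerivAt
  have cx (x : ℝ) : Continuous fun y : ℝ => (!₂[x, y] : Plane) :=
    continuous_mk.comp (f := fun y : ℝ => (x, y)) (by fun_prop)
  have cy (y : ℝ) : Continuous fun x : ℝ => (!₂[x, y] : Plane) :=
    continuous_mk.comp (f := fun x : ℝ => (x, y)) (by fun_prop)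
  have cn := (continuous_gradient hφ).norm
  have cnx (x : ℝ) : Continuous fun y : ℝ => ‖gradient φ !₂[x, y]‖ := cn.comp (cx x)
  have cEx (x : ℝ) : Continuous fun y : ℝ => ‖gradient φ !₂[x, y]‖ ^ 2 := (cnx x).pow 2
  have cE : Continuous (Function.uncurry fun x y : ℝ => ‖gradient φ !₂[x, y]‖ ^ 2) :=
    (cn.comp continuous_mk).pow 2
  have cI : Continuous fun x : ℝ => ∫ y in (-ε)..ε, ‖gradient φ !₂[x, y]‖ ^ 2 :=
    intervalIntegral.continuous_parametric_intervalIntegral_of_continuous' cE _ _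
  have hpt (x : ℝ) : |φ !₂[x, ε] - φ !₂[x, -ε]| ≤
      ∫ y in (-ε)..ε, ‖gradient φ !₂[x, y]‖ := by
    refine abs_sub_le_integral (F := fun y => φ !₂[x, y])
      (F' := fun y => fderiv ℝ φ !₂[x, y] !₂[0, 1])
      (fun y => (hD _).comp_hasDerivAt y (hasDerivAt_mk (hasDerivAt_const y x) (hasDerivAt_id y)))
      ?_ (cnx x) (by linarith) fun y _ => ?_
    · exact ((hφ.continuous_fderiv one_ne_zero).comp (cx x)).clm_apply continuous_const
    · refine (abs_fderiv_le _ _ _).trans_eq ?_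
      rw [norm_mk_eq zero_le_one (by norm_num), mul_one]
  have hpt' (x : ℝ) : (1 / (2 * d)) * |φ !₂[x, ε] - φ !₂[x, -ε]| ≤
      l * ε / (4 * d ^ 2) + (1 / (2 * l)) * ∫ y in (-ε)..ε, ‖gradient φ !₂[x, y]‖ ^ 2 := by
    have e : l * ε / (4 * d ^ 2) + (1 / (2 * l)) * (∫ y in (-ε)..ε, ‖gradient φ !₂[x, y]‖ ^ 2) =
        ∫ y in (-ε)..ε, (l / (8 * d ^ 2) + (1 / (2 * l)) * ‖gradient φ !₂[x, y]‖ ^ 2) := by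
      rw [intervalIntegral.integral_add intervalIntegrable_const
        ((continuous_const_mul_fun _ (cEx x)).intervalIntegrable _ _),
        intervalIntegral.integral_const_mul (1 / (2 * l)), intervalIntegral.integral_const]
      simp only [smul_eq_mul]
      ring
    refine (mul_le_mul_of_nonneg_left (hpt x) (by positivity)).trans ?_
    rw [e, ← intervalIntegral.integral_const_mul]
    refine intervalIntegral.integral_mono_on (by linarith)
      ((continuous_const_mul_fun _ (cnx x)).intervalIntegrable _ _)
      ((continuous_const.add
        (continuous_const_mul_fun _ (cEx x))).intervalIntegrable _ _)
      fun y _ => ?_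
    refine (mul_le_young (a := 1 / (2 * d)) (b := ‖gradient φ !₂[x, y]‖) hl).trans_eq ?_
    field_simp
    ring
  have c1 : Continuous fun x : ℝ => φ !₂[x, ε] := hφ.continuous.comp (cy ε)
  have c2 : Continuous fun x : ℝ => φ !₂[x, -ε] := hφ.continuous.comp (cy (-ε))
  have e1 : mouthMean d ε φ - mouthMean d (-ε) φ =
      (1 / (2 * d)) * ∫ x in (-d)..d, (φ !₂[x, ε] - φ !₂[x, -ε]) := by
    rw [intervalIntegral.integral_sub (c1.intervalIntegrable _ _) (c2.intervalIntegrable _ _),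
      mouthMean, mouthMean]
    ring
  rw [e1, abs_mul, abs_of_pos (by positivity : 0 < 1 / (2 * d))]
  calc _ ≤ (1 / (2 * d)) * ∫ x in (-d)..d, |φ !₂[x, ε] - φ !₂[x, -ε]| := by
        refine mul_le_mul_of_nonneg_left ?_ (by positivity)
        exact intervalIntegral.abs_integral_le_integral_abs (by linarith)
    _ ≤ ∫ x in (-d)..d, (l * ε / (4 * d ^ 2) +
          (1 / (2 * l)) * ∫ y in (-ε)..ε, ‖gradient φ !₂[x, y]‖ ^ 2) := by
        rw [← intervalIntegral.integral_const_mul]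
        exact intervalIntegral.integral_mono_on (by linarith)
          ((continuous_const_mul_fun _ (c1.sub c2).abs).intervalIntegrable _ _)
          ((continuous_const.add (continuous_const_mul_fun _ cI)).intervalIntegrable _ _)
          fun x _ => hpt' x
    _ = _ := by
        rw [intervalIntegral.integral_add intervalIntegrable_const
          ((continuous_const_mul_fun _ cI).intervalIntegrable _ _),
          intervalIntegral.integral_const_mul (1 / (2 * l)), intervalIntegral.integral_const]
        simp only [smul_eq_mul]
        field_simp
        ring

/-- The resistance of the passage and the two half-discs, with a bounded surplus for the
transition between the mouths of the passage and the half-circles of radius `d`. -/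
noncomputable def resistanceBound (ε ρ d : ℝ) : ℝ :=
  ε / d + 2 * (Real.log (ρ / 2 / d) / Real.pi + Real.pi / 2)

/-- Bounds of the same shape for resistances in series: both the resistances and the energies
add up. -/
lemma abs_sub_le_of_three {x y z w A₀ A₁ E₀ E₁ E₂ l : ℝ}
    (h₁ : |x - y| ≤ (l * A₁ + E₁ / l) / 2) (h₀ : |y - z| ≤ (l * A₀ + E₀ / l) / 2)
    (h₂ : |w - z| ≤ (l * A₁ + E₂ / l) / 2) :
    |x - w| ≤ (l * (A₀ + 2 * A₁) + (E₀ + E₁ + E₂) / l) / 2 := by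
  have e : (l * (A₀ + 2 * A₁) + (E₀ + E₁ + E₂) / l) / 2 =
      (l * A₁ + E₁ / l) / 2 + (l * A₀ + E₀ / l) / 2 + (l * A₁ + E₂ / l) / 2 := by ring
  rw [e]
  rw [abs_le] at *
  constructor <;> linarith

lemma abs_arcMean_sub_arcMean_le {φ : Plane → ℝ} (hφ : ContDiff ℝ 1 φ) {ε ρ d l : ℝ}
    (hε : 0 < ε) (hd : 0 < d) (hdρ : d < ρ / 2) (hl : 0 < l) :
    |arcMean ε ρ 1 φ - arcMean ε ρ (-1) φ| ≤
      (l * resistanceBound ε ρ d + (∫ x in cell ε ρ d 0, ‖gradient φ x‖ ^ 2) / l) / 2 := by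
  have cE : Continuous fun x => ‖gradient φ x‖ ^ 2 := (continuous_gradient hφ).norm.pow 2
  rw [setIntegral_cell hε (by linarith) hd cE, resistanceBound]
  have h1 := abs_arcMean_sub_mouthMean_le hφ (ε := ε) (Or.inl rfl) hd hdρ hl
  have h2 := abs_arcMean_sub_mouthMean_le hφ (ε := ε) (Or.inr rfl) hd hdρ hl
  have h3 := abs_mouthMean_sub_mouthMean_le hφ hε hd hl
  rw [one_mul] at h1
  rw [neg_one_mul] at h2
  exact abs_sub_le_of_three h1 h3 h2

/-! ### Traces on the semicircles -/

lemma polarPoint_mem_halfDisc {ε ρ s r θ : ℝ} (hs : s = 1 ∨ s = -1) (hr : 0 < r)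
    (hrρ : r < ρ / 2) (hθ : θ ∈ Set.Ioo 0 Real.pi) : polarPoint ε s r θ ∈ halfDisc ε ρ 0 s := by
  have hss : s * s = 1 := by rcases hs with rfl | rfl <;> norm_num
  have hsin := Real.sin_pos_of_mem_Ioo hθ
  rw [mem_halfDisc (by linarith), polarPoint_zero, polarPoint_one, ← mul_assoc, hss]
  refine ⟨?_, by nlinarith⟩
  calc _ = r ^ 2 := by
        linear_combination (r * Real.sin θ) ^ 2 * hss + r ^ 2 * Real.sin_sq_add_cos_sq θ
    _ < _ := by gcongr

lemma polarPoint_mem_semicircle {ε ρ s θ : ℝ} (hs : s = 1 ∨ s = -1) (hρ : 0 < ρ)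
    (hθ : θ ∈ Set.Ioo 0 Real.pi) : polarPoint ε s (ρ / 2) θ ∈ semicircle ε ρ 0 s := by
  have hss : s * s = 1 := by rcases hs with rfl | rfl <;> norm_num
  have hsin := Real.sin_pos_of_mem_Ioo hθ
  refine ⟨?_, ?_⟩
  · rw [(isOpen_halfDisc ε ρ 0 s).frontier_eq]
    refine ⟨?_, fun h => ?_⟩
    · have hc : Continuous fun r => polarPoint ε s r θ :=
        (continuous_polarPoint ε s).comp (by fun_prop : Continuous fun r : ℝ => (r, θ))
      refine mem_closure_of_tendsto (hc.continuousAt.continuousWithinAt.tendsto :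
        Tendsto _ (𝓝[<] (ρ / 2)) _) ?_
      filter_upwards [Ioo_mem_nhdsLT (half_pos hρ)] with r hr
      exact polarPoint_mem_halfDisc hs hr.1 hr.2 hθ
    · rw [mem_halfDisc hρ, polarPoint_zero, polarPoint_one] at h
      refine h.1.ne ?_
      linear_combination (ρ / 2 * Real.sin θ) ^ 2 * hss + (ρ / 2) ^ 2 * Real.sin_sq_add_cos_sq θ
  · change ¬ (s * polarPoint ε s (ρ / 2) θ 1 = ε)
    rw [polarPoint_one, ← mul_assoc, hss]
    nlinarith

/-- The semicircles consist of points of the circle strictly on their side of the sieve. -/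
lemma sq_add_sq_eq_and_lt_of_mem_semicircle {ε ρ s : ℝ} (hρ : 0 < ρ) {x : Plane}
    (hx : x ∈ semicircle ε ρ 0 s) :
    x 0 ^ 2 + (x 1 - s * ε) ^ 2 = (ρ / 2) ^ 2 ∧ ε < s * x 1 := by
  obtain ⟨hf, hl⟩ := hx
  rw [(isOpen_halfDisc ε ρ 0 s).frontier_eq] at hf
  have c1 : IsClosed {x : Plane | x 0 ^ 2 + (x 1 - s * ε) ^ 2 ≤ (ρ / 2) ^ 2 ∧ ε ≤ s * x 1} :=
    (isClosed_le (f := fun x : Plane => x 0 ^ 2 + (x 1 - s * ε) ^ 2) (by fun_prop)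
      continuous_const).inter
      (isClosed_le (g := fun x : Plane => s * x 1) continuous_const (by fun_prop))
  have h1 := closure_minimal (fun y hy => by
    rw [mem_halfDisc hρ] at hy
    exact ⟨hy.1.le, hy.2.le⟩) c1 hf.1
  have h2 : ε < s * x 1 := lt_of_le_of_ne h1.2 (Ne.symm hl)
  refine ⟨le_antisymm h1.1 (not_lt.1 fun h => hf.2 ?_), h2⟩
  exact (mem_halfDisc hρ x).2 ⟨h, h2⟩

lemma measurableSet_semicircle (ε ρ : ℝ) (k : ℤ) (s : ℝ) : MeasurableSet (semicircle ε ρ k s) := by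
  refine isClosed_frontier.measurableSet.diff (IsClosed.measurableSet ?_)
  exact isClosed_eq (f := fun x : Plane => s * x 1) (by fun_prop) continuous_const

/-- An arc is at most `π / 2` times as long as its chord. -/
lemma dist_polarPoint_ge {ε s R θ θ' : ℝ} (hs : s = 1 ∨ s = -1) (hR : 0 < R)
    (hθ : θ ∈ Set.Ioo 0 Real.pi) (hθ' : θ' ∈ Set.Ioo 0 Real.pi) :
    |θ - θ'| ≤ Real.pi / (2 * R) * dist (polarPoint ε s R θ) (polarPoint ε s R θ') := by
  have hss : s ^ 2 = 1 := by rcases hs with rfl | rfl <;> norm_num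
  have hπ := Real.pi_pos
  have hd : dist (polarPoint ε s R θ) (polarPoint ε s R θ') ^ 2 =
      (2 * R * Real.sin ((θ - θ') / 2)) ^ 2 := by
    rw [EuclideanSpace.dist_eq, Real.sq_sqrt (by positivity)]
    simp only [Fin.sum_univ_two, polarPoint_zero, polarPoint_one, Real.dist_eq, sq_abs]
    have h1 := Real.cos_sq' ((θ - θ') / 2)
    have h2 : Real.cos (θ - θ') = 2 * Real.cos ((θ - θ') / 2) ^ 2 - 1 := by
      rw [← Real.cos_two_mul]; ring_nf
    rw [Real.cos_sub] at h2
    linear_combination R ^ 2 * (Real.sin θ - Real.sin θ') ^ 2 * hss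
      + R ^ 2 * Real.sin_sq_add_cos_sq θ + R ^ 2 * Real.sin_sq_add_cos_sq θ'
      - 2 * R ^ 2 * h2 - 4 * R ^ 2 * h1
  have hd' : dist (polarPoint ε s R θ) (polarPoint ε s R θ') =
      2 * R * |Real.sin ((θ - θ') / 2)| := by
    rw [← abs_of_nonneg (dist_nonneg (x := polarPoint ε s R θ)),
      ← abs_of_pos (by positivity : 0 < 2 * R), ← abs_mul]
    exact (sq_eq_sq_iff_abs_eq_abs _ _).1 hd
  have hs' := Real.mul_abs_le_abs_sin (x := (θ - θ') / 2) (by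
    rw [abs_le]; constructor <;> linarith [hθ.1, hθ.2, hθ'.1, hθ'.2])
  rw [hd', abs_div, abs_two] at *
  calc |θ - θ'| = Real.pi * (2 / Real.pi * (|θ - θ'| / 2)) := by field_simp
    _ ≤ Real.pi * |Real.sin ((θ - θ') / 2)| := by gcongr
    _ = _ := by field_simp

/-- The angular measure on a semicircle is at most a multiple of the arc length. -/
lemma volume_restrict_map_le {ε ρ s : ℝ} (hs : s = 1 ∨ s = -1) (hρ : 0 < ρ) :
    (volume.restrict (Set.Ioo 0 Real.pi)).map (polarPoint ε s (ρ / 2)) ≤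
      ENNReal.ofReal (Real.pi / ρ) •
        (Measure.hausdorffMeasure 1).restrict (semicircle ε ρ 0 s) := by
  have hc : Continuous (polarPoint ε s (ρ / 2)) :=
    (continuous_polarPoint ε s).comp (by fun_prop : Continuous fun θ : ℝ => (ρ / 2, θ))
  refine Measure.le_iff.2 fun A hA => ?_
  rw [Measure.map_apply hc.measurable hA, Measure.restrict_apply (hc.measurable hA),
    Measure.smul_apply, Measure.restrict_apply hA, smul_eq_mul, ← hausdorffMeasure_real]
  have hanti : AntilipschitzWith (Real.toNNReal (Real.pi / ρ))
      (fun θ : Set.Ioo 0 Real.pi => polarPoint ε s (ρ / 2) θ) := by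
    refine AntilipschitzWith.of_le_mul_dist fun x y => ?_
    rw [Real.coe_toNNReal _ (by positivity), Subtype.dist_eq, Real.dist_eq]
    have := dist_polarPoint_ge (ε := ε) hs (half_pos hρ) x.2 y.2
    rwa [mul_div_cancel₀ ρ two_ne_zero] at this
  have h1 := hanti.le_hausdorffMeasure_image zero_le_one
    ((↑) ⁻¹' (polarPoint ε s (ρ / 2) ⁻¹' A) : Set (Set.Ioo 0 Real.pi))
  rw [← isometry_subtype_coe.hausdorffMeasure_image (Or.inl zero_le_one),
    Subtype.image_preimage_coe, Set.inter_comm, ENNReal.rpow_one] at h1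
  refine h1.trans (mul_le_mul_right (measure_mono ?_) _)
  rintro _ ⟨θ, hθ, rfl⟩
  exact ⟨hθ, polarPoint_mem_semicircle hs hρ θ.2⟩

/-- Convergence in `L²` on the semicircle entails convergence of the means. -/
lemma tendsto_arcMean {ε ρ s c : ℝ} (hs : s = 1 ∨ s = -1) (hρ : 0 < ρ) {φ : ℕ → Plane → ℝ}
    (hφ : ∀ j, Continuous (φ j))
    (h : Tendsto (fun j => eLpNorm (fun x => φ j x - c) 2
      ((Measure.hausdorffMeasure 1).restrict (semicircle ε ρ 0 s))) atTop (𝓝 0)) :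
    Tendsto (fun j => arcMean ε ρ s (φ j)) atTop (𝓝 c) := by
  have hc : Continuous (polarPoint ε s (ρ / 2)) :=
    (continuous_polarPoint ε s).comp (by fun_prop : Continuous fun θ : ℝ => (ρ / 2, θ))
  set ν := (volume : Measure ℝ).restrict (Set.Ioo 0 Real.pi) with hν
  have hνu : ν Set.univ ≠ ⊤ := by simp [hν]
  have : IsFiniteMeasure ν := ⟨hνu.lt_top⟩
  set K := ENNReal.ofReal (Real.pi / ρ) with hK
  have hbound (j : ℕ) : eLpNorm ((fun θ => φ j (polarPoint ε s (ρ / 2) θ)) - fun _ => c) 1 ν ≤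
      (K ^ (1 / (2 : ℝ≥0∞)).toReal • eLpNorm (fun x => φ j x - c) 2
        ((Measure.hausdorffMeasure 1).restrict (semicircle ε ρ 0 s))) *
        ν Set.univ ^ (1 / (1 : ℝ≥0∞).toReal - 1 / (2 : ℝ≥0∞).toReal) := by
    have hcont : Continuous ((fun θ => φ j (polarPoint ε s (ρ / 2) θ)) - fun _ => c) :=
      ((hφ j).comp hc).sub continuous_const
    refine (eLpNorm_le_eLpNorm_mul_rpow_measure_univ one_le_two
      hcont.aestronglyMeasurable).trans (mul_le_mul_left ?_ _)
    rw [← eLpNorm_smul_measure_of_ne_top ENNReal.ofNat_ne_top]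
    refine le_trans (le_of_eq ?_) (eLpNorm_mono_measure _ (volume_restrict_map_le hs hρ))
    have hc' : Continuous fun x => φ j x - c := (hφ j).sub continuous_const
    rw [eLpNorm_map_measure hc'.aestronglyMeasurable hc.aemeasurable]
    rfl
  have hlim : Tendsto (fun j => (K ^ (1 / (2 : ℝ≥0∞)).toReal • eLpNorm (fun x => φ j x - c) 2
        ((Measure.hausdorffMeasure 1).restrict (semicircle ε ρ 0 s))) *
        ν Set.univ ^ (1 / (1 : ℝ≥0∞).toReal - 1 / (2 : ℝ≥0∞).toReal)) atTop (𝓝 0) := by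
    have h1 : K ^ (1 / (2 : ℝ≥0∞)).toReal ≠ ⊤ :=
      ENNReal.rpow_ne_top_of_nonneg (by positivity) ENNReal.ofReal_ne_top
    have h2 : ν Set.univ ^ (1 / (1 : ℝ≥0∞).toReal - 1 / (2 : ℝ≥0∞).toReal) ≠ ⊤ :=
      ENNReal.rpow_ne_top_of_nonneg (by norm_num) hνu
    have := ENNReal.Tendsto.mul_const (ENNReal.Tendsto.const_mul h (Or.inr h1)) (Or.inr h2)
    simpa [smul_eq_mul] using this
  have key := tendsto_integral_of_L1' (μ := ν) (fun _ => c) aestronglyMeasurable_const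
    (F := fun j θ => φ j (polarPoint ε s (ρ / 2) θ)) (l := atTop)
    (Eventually.of_forall fun j => by
      exact (((hφ j).comp hc).continuousOn.integrableOn_compact isCompact_Icc).mono_set
        Set.Ioo_subset_Icc_self)
    (tendsto_of_tendsto_of_tendsto_of_le_of_le tendsto_const_nhds hlim (fun _ => zero_le) hbound)
  have e (j : ℕ) : arcMean ε ρ s (φ j) =
      (1 / Real.pi) * ∫ θ, φ j (polarPoint ε s (ρ / 2) θ) ∂ν := by
    rw [arcMean, intervalIntegral.integral_of_le Real.pi_pos.le, integral_Ioc_eq_integral_Ioo]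
  simp_rw [e]
  have e2 : c = (1 / Real.pi) * ∫ _, c ∂ν := by
    have hπ := Real.pi_pos
    rw [integral_const, hν, measureReal_restrict_apply_univ, Real.volume_real_Ioo_of_le hπ.le]
    simp only [smul_eq_mul]
    field_simp
    ring
  rw [e2]
  exact key.const_mul _

/-! ### The lower bound for the capacity -/

lemma memLp_gradient {ε ρ d : ℝ} {φ : Plane → ℝ} (hφ : ContDiff ℝ 1 φ) :
    MemLp (gradient φ) 2 (volume.restrict (cell ε ρ d 0)) := by
  have hc := continuous_gradient hφ
  rw [memLp_two_iff_integrable_sq_norm hc.aestronglyMeasurable]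
  exact ((hc.norm.pow 2).continuousOn.integrableOn_compact
    (isBounded_cell ε ρ d).isCompact_closure).mono_set subset_closure

lemma integral_norm_sq_eq {α : Type*} [MeasurableSpace α] {μ : Measure α} {F : α → Plane}
    (hF : MemLp F 2 μ) : ∫ x, ‖F x‖ ^ 2 ∂μ = (eLpNorm F 2 μ).toReal ^ 2 := by
  have h0 : 0 ≤ ∫ x, ‖F x‖ ^ 2 ∂μ := integral_nonneg fun x => by positivity
  rw [hF.eLpNorm_eq_integral_rpow_norm two_ne_zero ENNReal.ofNat_ne_top]
  simp only [ENNReal.toReal_ofNat, Real.rpow_two]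
  rw [ENNReal.toReal_ofReal (by positivity), ← Real.rpow_mul_natCast h0]
  norm_num

lemma resistanceBound_pos {ε ρ d : ℝ} (hε : 0 < ε) (hd : 0 < d) (hdρ : d < ρ / 2) :
    0 < resistanceBound ε ρ d := by
  have : 0 ≤ Real.log (ρ / 2 / d) := Real.log_nonneg (by rw [le_div_iff₀ hd]; linarith)
  have := Real.pi_pos
  unfold resistanceBound
  positivity

/-- The flux estimate passes to the limit of the approximating `C¹` functions; the parameter of the
Young inequality is the inverse of the resistance. -/
lemma inv_resistanceBound_le {ε ρ d : ℝ} (hε : 0 < ε) (hd : 0 < d) (hdρ : d < ρ / 2)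
    {u : Plane → ℝ} {F : Plane → Plane} (h : Admissible ε ρ d 0 u F) :
    (resistanceBound ε ρ d)⁻¹ ≤ ∫ x in cell ε ρ d 0, ‖F x‖ ^ 2 := by
  have hρ : 0 < ρ := by linarith
  have hR := resistanceBound_pos hε hd hdρ
  obtain ⟨hu, φ, hφ, -, hgrad, htr⟩ := h
  set S : ℝ → Set Plane := semicircle ε ρ 0 with hS
  set μ := volume.restrict (cell ε ρ d 0)
  have tr (s c : ℝ) (hs : s = 1 ∨ s = -1)
      (hsc : ∀ x ∈ S s, (S 1).indicator (fun _ => (1 : ℝ)) x = c) :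
      Tendsto (fun j => arcMean ε ρ s (φ j)) atTop (𝓝 c) := by
    refine tendsto_arcMean hs hρ (fun j => (hφ j).continuous) ?_
    refine tendsto_of_tendsto_of_tendsto_of_le_of_le tendsto_const_nhds htr (fun _ => zero_le)
      fun j => ?_
    refine le_trans (le_of_eq ?_) (eLpNorm_mono_measure _
      (Measure.restrict_mono_set (t := S 1 ∪ S (-1)) (s := S s) _ ?_))
    · refine eLpNorm_congr_ae ?_
      filter_upwards [ae_restrict_mem (measurableSet_semicircle ε ρ 0 s)] with x hx
      rw [hsc x hx]
    · rcases hs with rfl | rfl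
      · exact Set.subset_union_left
      · exact Set.subset_union_right
  have tr1 := tr 1 1 (Or.inl rfl) fun x hx => Set.indicator_of_mem hx _
  have tr0 := tr (-1) 0 (Or.inr rfl) fun x hx => Set.indicator_of_notMem (fun hx' => by
    have h1 := (sq_add_sq_eq_and_lt_of_mem_semicircle hρ hx).2
    have h2 := (sq_add_sq_eq_and_lt_of_mem_semicircle hρ hx').2
    linarith) _
  have hE (j : ℕ) := abs_arcMean_sub_arcMean_le (hφ j) hε hd hdρ (inv_pos.2 hR)
  set a := (eLpNorm F 2 μ).toReal with ha
  set δ : ℕ → ℝ := fun j => (eLpNorm (fun x => gradient (φ j) x - F x) 2 μ).toReal with hδ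
  have hδ0 : Tendsto δ atTop (𝓝 0) := by
    simpa using! (ENNReal.tendsto_toReal ENNReal.zero_ne_top).comp hgrad
  have hnorm (j : ℕ) : ∫ x in cell ε ρ d 0, ‖gradient (φ j) x‖ ^ 2 ≤ (δ j + a) ^ 2 := by
    have hm := memLp_gradient (ε := ε) (ρ := ρ) (d := d) (hφ j)
    have hs : MemLp (fun x => gradient (φ j) x - F x) 2 μ := hm.sub hu.memLp_grad
    rw [integral_norm_sq_eq hm]
    have h1 : eLpNorm (gradient (φ j)) 2 μ ≤
        eLpNorm (fun x => gradient (φ j) x - F x) 2 μ + eLpNorm F 2 μ := by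
      have := eLpNorm_add_le hs.aestronglyMeasurable hu.memLp_grad.aestronglyMeasurable one_le_two
      convert this using 2
      ext x : 1
      simp
    have h2 := ENNReal.toReal_mono (ENNReal.add_ne_top.2 ⟨hs.eLpNorm_ne_top,
      hu.memLp_grad.eLpNorm_ne_top⟩) h1
    rw [ENNReal.toReal_add hs.eLpNorm_ne_top hu.memLp_grad.eLpNorm_ne_top] at h2
    gcongr
  have hlim : |(1 : ℝ) - 0| ≤
      ((resistanceBound ε ρ d)⁻¹ * resistanceBound ε ρ d +
        (0 + a) ^ 2 / (resistanceBound ε ρ d)⁻¹) / 2 := by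
    refine le_of_tendsto_of_tendsto' (tr1.sub tr0).abs
      ((((hδ0.add_const a).pow 2).div_const _).const_add _ |>.div_const 2) fun j => ?_
    refine (hE j).trans ?_
    have := hnorm j
    gcongr
  rw [integral_norm_sq_eq hu.memLp_grad, ← ha]
  rw [inv_mul_cancel₀ hR.ne', div_inv_eq_mul, zero_add, sub_zero, abs_one] at hlim
  rw [inv_le_iff_one_le_mul₀ hR]
  linarith

/-! ### Smooth functions are admissible -/

lemma hasWeakGradient_gradient {G : Set Plane} {u : Plane → ℝ} (hu : ContDiff ℝ 1 u) :
    HasWeakGradient G u (gradient u) := by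
  intro ψ hψ hcs hsub
  have hψ1 : ContDiff ℝ 1 ψ := hψ.of_le (by exact_mod_cast le_top)
  have hz (x : Plane) (hx : x ∉ G) : ψ x = 0 ∧ gradient ψ x = 0 := by
    have hx' : x ∉ tsupport ψ := fun h => hx (hsub h)
    refine ⟨image_eq_zero_of_notMem_tsupport hx', ?_⟩
    rw [gradient, (HasFDerivAt.of_notMem_tsupport ℝ hx').fderiv, map_zero]
  have hgs : HasCompactSupport (gradient ψ) :=
    (hcs.fderiv ℝ).comp_left (g := (InnerProductSpace.toDual ℝ Plane).symm) (map_zero _)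
  have cu := continuous_gradient hu
  have cψ := continuous_gradient hψ1
  have i1 : Integrable fun x => u x • gradient ψ x :=
    (hu.continuous.smul cψ).integrable_of_hasCompactSupport hgs.smul_left
  have i2 : Integrable fun x => ψ x • gradient u x :=
    (hψ.continuous.smul cu).integrable_of_hasCompactSupport hcs.smul_right
  rw [setIntegral_eq_integral_of_forall_compl_eq_zero fun x hx => by rw [(hz x hx).2, smul_zero],
    setIntegral_eq_integral_of_forall_compl_eq_zero fun x hx => by rw [(hz x hx).1, zero_smul]]
  refine ext_inner_left ℝ fun v => ?_
  rw [inner_neg_right, ← integral_inner i1, ← integral_inner i2]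
  have hin (φ : Plane → ℝ) (x : Plane) : inner ℝ v (gradient φ x) = fderiv ℝ φ x v := by
    rw [real_inner_comm, inner_gradient_left]
  simp_rw [inner_smul_right, hin]
  have hfψ : Continuous fun x => fderiv ℝ ψ x v :=
    (hψ1.continuous_fderiv one_ne_zero).clm_apply continuous_const
  have hfu : Continuous fun x => fderiv ℝ u x v :=
    (hu.continuous_fderiv one_ne_zero).clm_apply continuous_const
  have := integral_mul_fderiv_eq_neg_fderiv_mul_of_integrable (μ := (volume : Measure Plane))
    (f := u) (g := ψ) (v := v)
    ((hfu.mul hψ.continuous).integrable_of_hasCompactSupport hcs.mul_left)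
    ((hu.continuous.mul hfψ).integrable_of_hasCompactSupport (hcs.fderiv_apply ℝ v).mul_left)
    ((hu.continuous.mul hψ.continuous).integrable_of_hasCompactSupport hcs.mul_left)
    (fun x _ => hu.differentiable one_ne_zero x) (fun x _ => hψ1.differentiable one_ne_zero x)
  rw [this]
  simp_rw [mul_comm]

lemma admissible_of_contDiff {ε ρ d : ℝ} {u : Plane → ℝ}
    (hu : ContDiff ℝ 1 u) (h1 : ∀ x ∈ semicircle ε ρ 0 1, u x = 1)
    (h0 : ∀ x ∈ semicircle ε ρ 0 (-1), u x = 0) : Admissible ε ρ d 0 u (gradient u) := by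
  refine ⟨⟨?_, memLp_gradient hu, hasWeakGradient_gradient hu⟩,
    fun _ => u, fun _ => hu, by simp, by simp, ?_⟩
  · rw [memLp_two_iff_integrable_sq hu.continuous.aestronglyMeasurable]
    exact ((hu.continuous.pow 2).continuousOn.integrableOn_compact
      (isBounded_cell ε ρ d).isCompact_closure).mono_set subset_closure
  · have hz : (fun x => u x - (semicircle ε ρ 0 1).indicator (fun _ => (1 : ℝ)) x)
        =ᵐ[(Measure.hausdorffMeasure 1).restrict
          (semicircle ε ρ 0 1 ∪ semicircle ε ρ 0 (-1))] 0 := by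
      filter_upwards [ae_restrict_mem ((measurableSet_semicircle ε ρ 0 1).union
        (measurableSet_semicircle ε ρ 0 (-1)))] with x hx
      by_cases hx1 : x ∈ semicircle ε ρ 0 1
      · simp [hx1, h1 x hx1]
      · simp [hx1, h0 x (hx.resolve_left hx1)]
    simp [eLpNorm_congr_ae hz]

/-! ### One-dimensional profiles -/

lemma hasDerivAt_primitive {k : ℝ → ℝ} (hk : Continuous k) (t : ℝ) :
    HasDerivAt (fun t => ∫ u in (0)..t, k u) (k t) t :=
  intervalIntegral.integral_hasDerivAt_right (hk.intervalIntegrable _ _)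
    (hk.stronglyMeasurableAtFilter _ _) hk.continuousAt

lemma contDiff_primitive {k : ℝ → ℝ} (hk : Continuous k) :
    ContDiff ℝ 1 (fun t => ∫ u in (0)..t, k u) := by
  rw [contDiff_one_iff_deriv]
  refine ⟨fun t => (hasDerivAt_primitive hk t).differentiableAt, ?_⟩
  rwa [funext fun t => (hasDerivAt_primitive hk t).deriv]

/-- The derivative of `logProfile`. -/
noncomputable def logSlope (t : ℝ) : ℝ := max (t - 1) 0 / max t 1 ^ 2

/-- A `C¹` substitute for the positive part of the logarithm: it vanishes up to `1` and equals
`log t + 1 / t - 1` from there on. -/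
noncomputable def logProfile (t : ℝ) : ℝ := ∫ u in (0)..t, logSlope u

lemma continuous_logSlope : Continuous logSlope := by
  refine Continuous.div (by fun_prop) (by fun_prop) fun t => ?_
  have : 1 ≤ max t 1 := le_max_right _ _
  positivity

lemma logSlope_of_le {t : ℝ} (ht : t ≤ 1) : logSlope t = 0 := by
  simp [logSlope, max_eq_right (sub_nonpos.2 ht)]

lemma logSlope_of_ge {t : ℝ} (ht : 1 ≤ t) : logSlope t = (t - 1) / t ^ 2 := by
  rw [logSlope, max_eq_left (sub_nonneg.2 ht), max_eq_left ht]

lemma logSlope_nonneg (t : ℝ) : 0 ≤ logSlope t := by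
  unfold logSlope
  positivity

lemma logSlope_mul_le (t : ℝ) : logSlope t * t ≤ 1 := by
  rcases le_total t 1 with h | h
  · simp [logSlope_of_le h]
  · rw [logSlope_of_ge h, div_mul_eq_mul_div, div_le_one (by positivity)]
    nlinarith

lemma logProfile_of_le {t : ℝ} (ht : t ≤ 1) : logProfile t = 0 := by
  refine intervalIntegral.integral_zero_ae (Eventually.of_forall fun u hu => logSlope_of_le ?_)
  exact (Set.mem_uIoc.1 hu).elim (fun h => h.2.trans ht) (fun h => h.2.trans zero_le_one)

lemma log_sub_one_le_logProfile {t : ℝ} (ht : 1 ≤ t) : Real.log t - 1 ≤ logProfile t := by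
  have h1 : ∫ u in (1)..t, logSlope u = (Real.log t + t⁻¹) - (Real.log 1 + 1⁻¹) := by
    refine intervalIntegral.integral_eq_sub_of_hasDerivAt (f := fun u => Real.log u + u⁻¹)
      (fun u hu => ?_) (continuous_logSlope.intervalIntegrable _ _)
    rw [Set.uIcc_of_le ht] at hu
    have hu0 : u ≠ 0 := by linarith [hu.1]
    rw [logSlope_of_ge hu.1]
    refine ((Real.hasDerivAt_log hu0).add (hasDerivAt_inv hu0)).congr_deriv ?_
    field_simp
    ring
  have h2 : logProfile t = logProfile 1 + ∫ u in (1)..t, logSlope u :=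
    (intervalIntegral.integral_add_adjacent_intervals
      (continuous_logSlope.intervalIntegrable _ _)
      (continuous_logSlope.intervalIntegrable _ _)).symm
  rw [h2, logProfile_of_le le_rfl, h1, Real.log_one]
  have : 0 ≤ t⁻¹ := by positivity
  norm_num
  linarith

/-- The derivative of `signedSquare`. -/
noncomputable def signedSquareSlope (M t : ℝ) : ℝ := 2 * max t 0 + 2 * M * max (-t) 0

/-- The `C¹` function equal to `t ^ 2` for `t ≥ 0` and to `-M * t ^ 2` for `t ≤ 0`. -/
noncomputable def signedSquare (M t : ℝ) : ℝ := ∫ u in (0)..t, signedSquareSlope M u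

lemma continuous_signedSquareSlope (M : ℝ) : Continuous (signedSquareSlope M) := by
  unfold signedSquareSlope
  fun_prop

lemma signedSquareSlope_of_nonneg (M : ℝ) {t : ℝ} (ht : 0 ≤ t) : signedSquareSlope M t = 2 * t := by
  rw [signedSquareSlope, max_eq_left ht, max_eq_right (by linarith)]; ring

lemma signedSquare_of_nonneg (M : ℝ) {t : ℝ} (ht : 0 ≤ t) : signedSquare M t = t ^ 2 := by
  have : signedSquare M t = ∫ u in (0)..t, 2 * u := by
    refine intervalIntegral.integral_congr fun u hu => ?_
    rw [Set.uIcc_of_le ht] at hu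
    exact signedSquareSlope_of_nonneg M hu.1
  rw [this, intervalIntegral.integral_const_mul, integral_id]
  ring

lemma signedSquare_of_nonpos (M : ℝ) {t : ℝ} (ht : t ≤ 0) : signedSquare M t = -M * t ^ 2 := by
  have : signedSquare M t = ∫ u in (0)..t, (-2 * M) * u := by
    refine intervalIntegral.integral_congr fun u hu => ?_
    rw [Set.uIcc_of_ge ht] at hu
    simp only [signedSquareSlope]
    rw [max_eq_right hu.2, max_eq_left (by linarith [hu.2])]
    ring
  rw [this, intervalIntegral.integral_const_mul, integral_id]
  ring

/-- The derivative of `ramp`: a trapezoidal bump supported in `[-ε, ε]`. -/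
noncomputable def rampSlope (ε m t : ℝ) : ℝ := min 1 (max ((ε - |t|) / m) 0)

/-- A `C¹` function that is constant beyond `±ε` and has slope `1` on `[-(ε - m), ε - m]`. -/
noncomputable def ramp (ε m t : ℝ) : ℝ := ∫ u in (0)..t, rampSlope ε m u

lemma continuous_rampSlope (ε m : ℝ) : Continuous (rampSlope ε m) := by
  unfold rampSlope
  fun_prop

lemma rampSlope_nonneg (ε m t : ℝ) : 0 ≤ rampSlope ε m t :=
  le_min zero_le_one (le_max_right _ _)

lemma rampSlope_le_one (ε m t : ℝ) : rampSlope ε m t ≤ 1 := min_le_left _ _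

lemma rampSlope_of_le {ε m t : ℝ} (hm : 0 < m) (ht : ε ≤ |t|) : rampSlope ε m t = 0 := by
  rw [rampSlope, max_eq_right (div_nonpos_of_nonpos_of_nonneg (by linarith) hm.le)]
  norm_num

lemma ramp_neg (ε m t : ℝ) : ramp ε m (-t) = -ramp ε m t := by
  have h := intervalIntegral.integral_comp_neg (a := 0) (b := t) (rampSlope ε m)
  have e : ∀ u, rampSlope ε m (-u) = rampSlope ε m u := fun u => by simp [rampSlope]
  simp only [e, neg_zero] at h
  rw [ramp, ramp, h, intervalIntegral.integral_symm]

lemma ramp_of_ge {ε m t : ℝ} (hm : 0 < m) (ht : ε ≤ t) : ramp ε m t = ramp ε m ε := by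
  have h0 : ∫ u in ε..t, rampSlope ε m u = 0 := by
    refine intervalIntegral.integral_zero_ae (Eventually.of_forall fun u hu => ?_)
    rw [Set.uIoc_of_le ht] at hu
    exact rampSlope_of_le hm (hu.1.le.trans (le_abs_self u))
  rw [ramp, ← intervalIntegral.integral_add_adjacent_intervals
    ((continuous_rampSlope ε m).intervalIntegrable 0 ε)
    ((continuous_rampSlope ε m).intervalIntegrable ε t), h0, add_zero, ramp]

lemma sub_le_ramp {ε m : ℝ} (hm : 0 < m) (hmε : m ≤ ε) : ε - m ≤ ramp ε m ε := by
  have h1 : ∫ u in (0)..(ε - m), rampSlope ε m u = ∫ _ in (0)..(ε - m), (1 : ℝ) := by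
    refine intervalIntegral.integral_congr fun u hu => ?_
    rw [Set.uIcc_of_le (by linarith)] at hu
    refine min_eq_left (le_max_of_le_left ?_)
    rw [le_div_iff₀ hm, abs_of_nonneg hu.1]
    linarith [hu.2]
  have h2 : 0 ≤ ∫ u in (ε - m)..ε, rampSlope ε m u :=
    intervalIntegral.integral_nonneg (by linarith) fun u _ => rampSlope_nonneg ε m u
  rw [ramp, ← intervalIntegral.integral_add_adjacent_intervals
    ((continuous_rampSlope ε m).intervalIntegrable 0 (ε - m))
    ((continuous_rampSlope ε m).intervalIntegrable (ε - m) ε), h1]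
  simp only [intervalIntegral.integral_const, smul_eq_mul]
  linarith

/-! ### The trial function -/

/-- The squared distance to the middle of the upper mouth, in units of `(2 d) ^ 2`, for points
above the sieve. Below the level of the mouth the square of the vertical distance is replaced by
a negative multiple of itself, so large that the value is nonpositive on the lower half-disc. -/
noncomputable def scaledSq (ε ρ d x y : ℝ) : ℝ :=
  (x ^ 2 + signedSquare (ρ ^ 2 / (16 * ε ^ 2)) (y - ε)) / (4 * d ^ 2)

/-- The potential of a unit flux, up to smoothing: `1 / π` times the logarithm of the distance to
the mouths in the half-discs, and a linear function in the passage. -/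
noncomputable def potential (ε ρ d : ℝ) (x : Plane) : ℝ :=
  (logProfile (scaledSq ε ρ d (x 0) (x 1)) - logProfile (scaledSq ε ρ d (x 0) (-x 1)))
    / (2 * Real.pi) + ramp ε (min ε d) (x 1) / (2 * d)

/-- The horizontal derivative of `potential`. -/
noncomputable def potentialDx (ε ρ d x y : ℝ) : ℝ :=
  (logSlope (scaledSq ε ρ d x y) - logSlope (scaledSq ε ρ d x (-y))) * x / (4 * Real.pi * d ^ 2)

/-- The vertical derivative of `potential`. -/
noncomputable def potentialDy (ε ρ d x y : ℝ) : ℝ :=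
  (logSlope (scaledSq ε ρ d x y) * signedSquareSlope (ρ ^ 2 / (16 * ε ^ 2)) (y - ε)
    + logSlope (scaledSq ε ρ d x (-y)) * signedSquareSlope (ρ ^ 2 / (16 * ε ^ 2)) (-y - ε))
    / (8 * Real.pi * d ^ 2) + rampSlope ε (min ε d) y / (2 * d)

lemma contDiff_potential (ε ρ d : ℝ) : ContDiff ℝ 1 (potential ε ρ d) := by
  have h1 : ContDiff ℝ 1 logProfile := contDiff_primitive continuous_logSlope
  have h2 : ContDiff ℝ 1 (signedSquare (ρ ^ 2 / (16 * ε ^ 2))) :=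
    contDiff_primitive (continuous_signedSquareSlope _)
  have h3 : ContDiff ℝ 1 (ramp ε (min ε d)) := contDiff_primitive (continuous_rampSlope _ _)
  have h4 : ContDiff ℝ 1 fun x : Plane => x 0 := (EuclideanSpace.proj 0 : Plane →L[ℝ] ℝ).contDiff
  have h5 : ContDiff ℝ 1 fun x : Plane => x 1 := (EuclideanSpace.proj 1 : Plane →L[ℝ] ℝ).contDiff
  have h6 : ContDiff ℝ 1 fun x : Plane => scaledSq ε ρ d (x 0) (x 1) :=
    ((h4.pow 2).add (h2.comp (h5.sub contDiff_const))).div_const _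
  have h7 : ContDiff ℝ 1 fun x : Plane => scaledSq ε ρ d (x 0) (-x 1) :=
    ((h4.pow 2).add (h2.comp (h5.neg.sub contDiff_const))).div_const _
  exact (((h1.comp h6).sub (h1.comp h7)).div_const _).add ((h3.comp h5).div_const _)

lemma hasFDerivAt_potential (ε ρ d : ℝ) (x : Plane) :
    HasFDerivAt (potential ε ρ d)
      (potentialDx ε ρ d (x 0) (x 1) • (EuclideanSpace.proj 0 : Plane →L[ℝ] ℝ)
        + potentialDy ε ρ d (x 0) (x 1) • (EuclideanSpace.proj 1 : Plane →L[ℝ] ℝ)) x := by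
  have p0 : HasFDerivAt (fun x : Plane => x 0) (EuclideanSpace.proj 0 : Plane →L[ℝ] ℝ) x :=
    (EuclideanSpace.proj 0 : Plane →L[ℝ] ℝ).hasFDerivAt
  have p1 : HasFDerivAt (fun x : Plane => x 1) (EuclideanSpace.proj 1 : Plane →L[ℝ] ℝ) x :=
    (EuclideanSpace.proj 1 : Plane →L[ℝ] ℝ).hasFDerivAt
  set M := ρ ^ 2 / (16 * ε ^ 2) with hM
  have dS (t : ℝ) : HasDerivAt (signedSquare M) (signedSquareSlope M t) t :=
    hasDerivAt_primitive (continuous_signedSquareSlope M) t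
  have dL (t : ℝ) : HasDerivAt logProfile (logSlope t) t :=
    hasDerivAt_primitive continuous_logSlope t
  have dR (t : ℝ) : HasDerivAt (ramp ε (min ε d)) (rampSlope ε (min ε d) t) t :=
    hasDerivAt_primitive (continuous_rampSlope ε (min ε d)) t
  have s1 := (((p0.pow 2).add ((dS (x 1 - ε)).comp_hasFDerivAt x (p1.sub_const ε))).mul_const
    (4 * d ^ 2)⁻¹)
  have s2 := (((p0.pow 2).add ((dS (-x 1 - ε)).comp_hasFDerivAt x (p1.neg.sub_const ε))).mul_const
    (4 * d ^ 2)⁻¹)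
  have g1 := (dL (scaledSq ε ρ d (x 0) (x 1))).comp_hasFDerivAt x s1
  have g2 := (dL (scaledSq ε ρ d (x 0) (-x 1))).comp_hasFDerivAt x s2
  have r := (dR (x 1)).comp_hasFDerivAt x p1
  have := ((g1.sub g2).mul_const (2 * Real.pi)⁻¹).add (r.mul_const (2 * d)⁻¹)
  refine this.congr_fderiv ?_
  ext v
  simp [potentialDx, potentialDy, ← hM]
  field_simp
  ring

lemma norm_gradient_sq {φ : Plane → ℝ} {a b : ℝ} {x : Plane}
    (h : HasFDerivAt φ (a • (EuclideanSpace.proj 0 : Plane →L[ℝ] ℝ)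
      + b • (EuclideanSpace.proj 1 : Plane →L[ℝ] ℝ)) x) :
    ‖gradient φ x‖ ^ 2 = a ^ 2 + b ^ 2 := by
  have : HasGradientAt φ (!₂[a, b] : Plane) x := by
    rw [hasGradientAt_iff_hasFDerivAt]
    refine h.congr_fderiv ?_
    ext v
    simp [PiLp.inner_apply, Fin.sum_univ_two]
    ring
  rw [this.gradient, norm_mk_sq]

lemma norm_gradient_potential_sq (ε ρ d : ℝ) (x : Plane) :
    ‖gradient (potential ε ρ d) x‖ ^ 2 =
      potentialDx ε ρ d (x 0) (x 1) ^ 2 + potentialDy ε ρ d (x 0) (x 1) ^ 2 :=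
  norm_gradient_sq (hasFDerivAt_potential ε ρ d x)

lemma potential_neg (ε ρ d x y : ℝ) : potential ε ρ d !₂[x, -y] = -potential ε ρ d !₂[x, y] := by
  simp only [potential, Matrix.cons_val_zero, Matrix.cons_val_one, neg_neg, ramp_neg]
  ring

lemma potentialDx_neg (ε ρ d x y : ℝ) :
    potentialDx ε ρ d x (-y) = -potentialDx ε ρ d x y := by
  simp only [potentialDx, neg_neg]
  ring

lemma potentialDy_neg (ε ρ d x y : ℝ) :
    potentialDy ε ρ d x (-y) = potentialDy ε ρ d x y := by
  simp only [potentialDy, neg_neg, rampSlope, abs_neg]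
  ring

lemma scaledSq_of_mouth_le {ε ρ d x y : ℝ} (hy : ε ≤ y) :
    scaledSq ε ρ d x y = (x ^ 2 + (y - ε) ^ 2) / (4 * d ^ 2) := by
  rw [scaledSq, signedSquare_of_nonneg _ (by linarith)]

lemma scaledSq_le_of_passage {ε ρ d x y : ℝ} (hd : 0 < d) (hx : |x| ≤ d) (hy : y ≤ ε) :
    scaledSq ε ρ d x y ≤ 1 := by
  rw [scaledSq, signedSquare_of_nonpos _ (by linarith), div_le_one (by positivity)]
  have h1 : 0 ≤ ρ ^ 2 / (16 * ε ^ 2) * (y - ε) ^ 2 := by positivity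
  have h2 : x ^ 2 ≤ d ^ 2 := sq_le_sq' (abs_le.1 hx).1 (abs_le.1 hx).2
  nlinarith

lemma scaledSq_le_of_opposite {ε ρ d x y : ℝ} (hε : 0 < ε) (hd : 0 < d)
    (hx : x ^ 2 ≤ (ρ / 2) ^ 2) (hy : y ≤ -ε) : scaledSq ε ρ d x y ≤ 1 := by
  rw [scaledSq, signedSquare_of_nonpos _ (by linarith), div_le_one (by positivity)]
  have h1 : ρ ^ 2 / (16 * ε ^ 2) * (2 * ε) ^ 2 ≤ ρ ^ 2 / (16 * ε ^ 2) * (y - ε) ^ 2 := by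
    refine mul_le_mul_of_nonneg_left ?_ (by positivity)
    nlinarith
  have h2 : ρ ^ 2 / (16 * ε ^ 2) * (2 * ε) ^ 2 = (ρ / 2) ^ 2 := by field_simp; ring
  nlinarith [sq_nonneg d]

section
variable {ε ρ d : ℝ}

lemma potential_gradient_passage (hd : 0 < d) {x y : ℝ} (hx : |x| ≤ d)
    (hy : |y| ≤ ε) : ‖gradient (potential ε ρ d) !₂[x, y]‖ ^ 2 ≤ (1 / (2 * d)) ^ 2 := by
  have h1 := logSlope_of_le (scaledSq_le_of_passage (ρ := ρ) hd hx (abs_le.1 hy).2)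
  have h2 := logSlope_of_le (scaledSq_le_of_passage (ε := ε) (ρ := ρ) (y := -y) hd hx
    (by linarith [(abs_le.1 hy).1]))
  rw [norm_gradient_potential_sq]
  simp only [Matrix.cons_val_zero, Matrix.cons_val_one, potentialDx, potentialDy, h1, h2]
  have h3 := rampSlope_nonneg ε (min ε d) y
  have h4 := rampSlope_le_one ε (min ε d) y
  have : (rampSlope ε (min ε d) y / (2 * d)) ^ 2 ≤ (1 / (2 * d)) ^ 2 := by gcongr
  simpa using this

lemma potential_gradient_halfDisc (hε : 0 < ε) (hd : 0 < d) {s r θ : ℝ} (hs : s = 1 ∨ s = -1)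
    (hr : r ∈ Set.Icc 0 (ρ / 2)) (hθ : θ ∈ Set.Icc 0 Real.pi) :
    ‖gradient (potential ε ρ d) (polarPoint ε s r θ)‖ ^ 2 =
      (logSlope (r ^ 2 / (4 * d ^ 2)) * r / (4 * Real.pi * d ^ 2)) ^ 2 := by
  have hsin : 0 ≤ r * Real.sin θ := mul_nonneg hr.1 (Real.sin_nonneg_of_mem_Icc hθ)
  have e : ‖gradient (potential ε ρ d) (polarPoint ε s r θ)‖ ^ 2 =
      potentialDx ε ρ d (r * Real.cos θ) (ε + r * Real.sin θ) ^ 2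
        + potentialDy ε ρ d (r * Real.cos θ) (ε + r * Real.sin θ) ^ 2 := by
    rw [norm_gradient_potential_sq, polarPoint_zero, polarPoint_one]
    rcases hs with rfl | rfl
    · rw [one_mul]
    · rw [neg_one_mul, potentialDx_neg, potentialDy_neg, neg_sq]
  have hcs := Real.sin_sq_add_cos_sq θ
  have h1 : scaledSq ε ρ d (r * Real.cos θ) (ε + r * Real.sin θ) = r ^ 2 / (4 * d ^ 2) := by
    rw [scaledSq_of_mouth_le (by linarith)]
    congr 1
    linear_combination r ^ 2 * hcs
  have h2 : logSlope (scaledSq ε ρ d (r * Real.cos θ) (-(ε + r * Real.sin θ))) = 0 := by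
    refine logSlope_of_le (scaledSq_le_of_opposite hε hd ?_ (by linarith))
    have : r ^ 2 ≤ (ρ / 2) ^ 2 := pow_le_pow_left₀ hr.1 hr.2 2
    nlinarith [sq_nonneg (r * Real.sin θ)]
  have h3 : rampSlope ε (min ε d) (ε + r * Real.sin θ) = 0 :=
    rampSlope_of_le (lt_min hε hd) (by rw [abs_of_nonneg (by linarith)]; linarith)
  rw [e, potentialDx, potentialDy, h1, h2, h3, signedSquareSlope_of_nonneg _ (by linarith)]
  field_simp
  linear_combination 256 * r ^ 2 * logSlope (r ^ 2 / (4 * d ^ 2)) ^ 2 * hcs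

/-- The smoothing by `logProfile` does not raise the energy density of the radial potential
`log r / π`. -/
lemma radial_bound (hd : 0 < d) {r : ℝ} (hr : 0 < r) :
    r * (logSlope (r ^ 2 / (4 * d ^ 2)) * r / (4 * Real.pi * d ^ 2)) ^ 2 ≤
      (1 / Real.pi ^ 2) * r⁻¹ := by
  have hπ := Real.pi_pos
  have h1 := logSlope_mul_le (r ^ 2 / (4 * d ^ 2))
  have h0 := logSlope_nonneg (r ^ 2 / (4 * d ^ 2))
  have e : r * (logSlope (r ^ 2 / (4 * d ^ 2)) * r / (4 * Real.pi * d ^ 2)) ^ 2 =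
      (1 / Real.pi ^ 2) * r⁻¹ * (logSlope (r ^ 2 / (4 * d ^ 2)) * (r ^ 2 / (4 * d ^ 2))) ^ 2 := by
    field_simp
  rw [e]
  refine mul_le_of_le_one_right (by positivity) ?_
  exact pow_le_one₀ (by positivity) h1

lemma potential_energy_halfDisc (hε : 0 < ε) (hd : 0 < d) (hdρ : 2 * d ≤ ρ / 2) {s : ℝ}
    (hs : s = 1 ∨ s = -1) :
    ∫ r in (0)..ρ / 2, ∫ θ in (0)..Real.pi,
      r * ‖gradient (potential ε ρ d) (polarPoint ε s r θ)‖ ^ 2 ≤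
      Real.log (ρ / (4 * d)) / Real.pi := by
  have hπ := Real.pi_pos
  set g : ℝ → ℝ := fun r =>
    Real.pi * (r * (logSlope (r ^ 2 / (4 * d ^ 2)) * r / (4 * Real.pi * d ^ 2)) ^ 2) with hg
  have cg : Continuous g := by
    have := continuous_logSlope
    fun_prop
  have e1 : ∫ r in (0)..ρ / 2, ∫ θ in (0)..Real.pi,
      r * ‖gradient (potential ε ρ d) (polarPoint ε s r θ)‖ ^ 2 = ∫ r in (0)..ρ / 2, g r := by
    refine intervalIntegral.integral_congr fun r hr => ?_
    rw [Set.uIcc_of_le (by linarith)] at hr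
    have : ∫ θ in (0)..Real.pi, r * ‖gradient (potential ε ρ d) (polarPoint ε s r θ)‖ ^ 2 =
        ∫ _ in (0)..Real.pi,
          r * (logSlope (r ^ 2 / (4 * d ^ 2)) * r / (4 * Real.pi * d ^ 2)) ^ 2 := by
      refine intervalIntegral.integral_congr fun θ hθ => ?_
      rw [Set.uIcc_of_le hπ.le] at hθ
      simp only [potential_gradient_halfDisc hε hd hs hr hθ]
    simp only [this, intervalIntegral.integral_const, sub_zero, smul_eq_mul, hg]
  have e2 : ∫ r in (0)..(2 * d), g r = 0 := by
    refine (intervalIntegral.integral_congr (g := fun _ => (0 : ℝ)) fun r hr => ?_).trans (by simp)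
    rw [Set.uIcc_of_le (by linarith)] at hr
    have : r ^ 2 / (4 * d ^ 2) ≤ 1 := by
      rw [div_le_one (by positivity)]
      nlinarith [hr.1, hr.2]
    simp [hg, logSlope_of_le this]
  have e3 : ∫ r in (2 * d)..ρ / 2, g r ≤ ∫ r in (2 * d)..ρ / 2, (1 / Real.pi) * r⁻¹ := by
    refine intervalIntegral.integral_mono_on hdρ (cg.intervalIntegrable _ _) ?_ fun r hr => ?_
    · refine ContinuousOn.intervalIntegrable_of_Icc hdρ fun r hr => ?_
      have hr0 : 0 < r := lt_of_lt_of_le (by linarith) hr.1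
      exact ((continuousAt_inv₀ hr0.ne').const_mul _).continuousWithinAt
    · have hr0 : 0 < r := lt_of_lt_of_le (by linarith) hr.1
      calc g r ≤ Real.pi * ((1 / Real.pi ^ 2) * r⁻¹) := by
            exact mul_le_mul_of_nonneg_left (radial_bound hd hr0) hπ.le
        _ = _ := by field_simp
  rw [e1, ← intervalIntegral.integral_add_adjacent_intervals (cg.intervalIntegrable 0 (2 * d))
    (cg.intervalIntegrable _ _), e2, zero_add]
  refine e3.trans (le_of_eq ?_)
  rw [intervalIntegral.integral_const_mul, integral_inv_of_pos (by linarith) (by linarith)]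
  have : ρ / 2 / (2 * d) = ρ / (4 * d) := by field_simp; norm_num
  rw [this]
  ring

/-- The energy of the potential of a unit flux: the resistance of the passage and of the two
half-annuli between the radii `2 d` and `ρ / 2`. -/
lemma potential_energy_le (hε : 0 < ε) (hd : 0 < d) (hdρ : 2 * d ≤ ρ / 2) :
    ∫ x in cell ε ρ d 0, ‖gradient (potential ε ρ d) x‖ ^ 2 ≤
      ε / d + 2 * (Real.log (ρ / (4 * d)) / Real.pi) := by
  have cE : Continuous fun x => ‖gradient (potential ε ρ d) x‖ ^ 2 :=
    (continuous_gradient (contDiff_potential ε ρ d)).norm.pow 2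
  rw [setIntegral_cell hε (by linarith) hd cE]
  have h1 := potential_energy_halfDisc hε hd hdρ (Or.inl rfl)
  have h2 := potential_energy_halfDisc hε hd hdρ (Or.inr rfl)
  have h3 : ∫ x in (-d)..d, ∫ y in (-ε)..ε, ‖gradient (potential ε ρ d) !₂[x, y]‖ ^ 2 ≤ ε / d := by
    have cE' : Continuous (Function.uncurry fun x y : ℝ =>
        ‖gradient (potential ε ρ d) !₂[x, y]‖ ^ 2) := cE.comp continuous_mk
    have cI : Continuous fun x : ℝ =>
        ∫ y in (-ε)..ε, ‖gradient (potential ε ρ d) !₂[x, y]‖ ^ 2 :=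
      intervalIntegral.continuous_parametric_intervalIntegral_of_continuous'
        cE' _ _
    calc _ ≤ ∫ _ in (-d)..d, ∫ _ in (-ε)..ε, (1 / (2 * d)) ^ 2 := by
          refine intervalIntegral.integral_mono_on (by linarith) (cI.intervalIntegrable _ _)
            intervalIntegrable_const fun x hx => ?_
          refine intervalIntegral.integral_mono_on (by linarith) (Continuous.intervalIntegrable
            (cE.comp (continuous_mk.comp (f := fun y : ℝ => (x, y)) (by fun_prop))) _ _)
            intervalIntegrable_const fun y hy => ?_
          exact potential_gradient_passage hd (abs_le.2 hx) (abs_le.2 hy)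
      _ = ε / d := by
          simp only [intervalIntegral.integral_const, smul_eq_mul]
          field_simp
          ring
  linarith

/-- The value of `potential` on the upper semicircle. -/
noncomputable def potentialEnd (ε ρ d : ℝ) : ℝ :=
  logProfile ((ρ / 2) ^ 2 / (4 * d ^ 2)) / (2 * Real.pi) + ramp ε (min ε d) ε / (2 * d)

lemma potential_upper (hε : 0 < ε) (hd : 0 < d) {x y : ℝ}
    (hxy : x ^ 2 + (y - ε) ^ 2 = (ρ / 2) ^ 2) (hy : ε < y) :
    potential ε ρ d !₂[x, y] = potentialEnd ε ρ d := by
  have h1 : logProfile (scaledSq ε ρ d x (-y)) = 0 :=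
    logProfile_of_le (scaledSq_le_of_opposite hε hd (by nlinarith [sq_nonneg (y - ε)])
      (by linarith))
  simp only [potential, Matrix.cons_val_zero, Matrix.cons_val_one]
  rw [h1, scaledSq_of_mouth_le hy.le, hxy, ramp_of_ge (lt_min hε hd) hy.le, sub_zero, potentialEnd]

lemma eq_mk (x : Plane) : x = !₂[x 0, x 1] := by
  ext i
  fin_cases i <;> rfl

lemma potential_semicircle_one (hε : 0 < ε) (hρ : 0 < ρ) (hd : 0 < d) {x : Plane}
    (hx : x ∈ semicircle ε ρ 0 1) : potential ε ρ d x = potentialEnd ε ρ d := by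
  obtain ⟨h1, h2⟩ := sq_add_sq_eq_and_lt_of_mem_semicircle hρ hx
  rw [one_mul] at h1 h2
  rw [eq_mk x]
  exact potential_upper hε hd h1 h2

lemma potential_semicircle_neg_one (hε : 0 < ε) (hρ : 0 < ρ) (hd : 0 < d) {x : Plane}
    (hx : x ∈ semicircle ε ρ 0 (-1)) : potential ε ρ d x = -potentialEnd ε ρ d := by
  obtain ⟨h1, h2⟩ := sq_add_sq_eq_and_lt_of_mem_semicircle hρ hx
  rw [neg_one_mul] at h1 h2
  rw [eq_mk x, ← neg_neg (x 1), potential_neg]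
  rw [potential_upper hε hd (by rw [← h1]; ring) h2]

/-- The potential drop of a unit flux differs from its energy by a bounded amount. -/
lemma sub_two_le_potentialEnd (hε : 0 < ε) (hd : 0 < d) (hdρ : 2 * d ≤ ρ / 2) :
    ε / d + 2 * (Real.log (ρ / (4 * d)) / Real.pi) - 2 ≤ 2 * potentialEnd ε ρ d := by
  have hπ := Real.pi_pos
  have h4 : 1 ≤ ρ / (4 * d) := by rw [le_div_iff₀ (by positivity)]; linarith
  have hsq : (ρ / 2) ^ 2 / (4 * d ^ 2) = (ρ / (4 * d)) ^ 2 := by field_simp; norm_num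
  have h1 := log_sub_one_le_logProfile (one_le_pow₀ h4 (n := 2))
  rw [Real.log_pow] at h1
  push_cast at h1
  have h2 := sub_le_ramp (lt_min hε hd) (min_le_left ε d)
  have h3 := min_le_right ε d
  have h5 : (ε - d) / d ≤ 2 * (ramp ε (min ε d) ε / (2 * d)) := by
    calc (ε - d) / d ≤ ramp ε (min ε d) ε / d := by gcongr; linarith
      _ = _ := by field_simp
  have h6 : (2 * Real.log (ρ / (4 * d)) - 1) / Real.pi ≤
      2 * (logProfile ((ρ / (4 * d)) ^ 2) / (2 * Real.pi)) := by
    calc _ ≤ logProfile ((ρ / (4 * d)) ^ 2) / Real.pi := by gcongr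
      _ = _ := by field_simp
  have h7 : (ε - d) / d = ε / d - 1 := by field_simp
  have h8 : (2 * Real.log (ρ / (4 * d)) - 1) / Real.pi =
      2 * (Real.log (ρ / (4 * d)) / Real.pi) - 1 / Real.pi := by ring
  have h9 : 1 / Real.pi ≤ 1 := by rw [div_le_one hπ]; linarith [Real.pi_gt_three]
  rw [potentialEnd, hsq]
  linarith

/-- The potential, rescaled to a drop of `1`, competes in the definition of the capacity. -/
lemma exists_admissible (hε : 0 < ε) (hd : 0 < d) (hdρ : 2 * d ≤ ρ / 2)
    (hT : 2 < ε / d + 2 * (Real.log (ρ / (4 * d)) / Real.pi)) :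
    ∃ u F, Admissible ε ρ d 0 u F ∧ ∫ x in cell ε ρ d 0, ‖F x‖ ^ 2 ≤
      (ε / d + 2 * (Real.log (ρ / (4 * d)) / Real.pi)) /
        (ε / d + 2 * (Real.log (ρ / (4 * d)) / Real.pi) - 2) ^ 2 := by
  have hρ : 0 < ρ := by linarith
  have hW := sub_two_le_potentialEnd hε hd hdρ
  set T := ε / d + 2 * (Real.log (ρ / (4 * d)) / Real.pi) with hTdef
  set W := potentialEnd ε ρ d with hWdef
  have hW0 : 0 < W := by linarith
  set u : Plane → ℝ := fun x => 1 / 2 + (1 / (2 * W)) * potential ε ρ d x with hu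
  have hC : ContDiff ℝ 1 u := contDiff_const.add (contDiff_const.mul (contDiff_potential ε ρ d))
  refine ⟨u, gradient u, admissible_of_contDiff hC (fun x hx => ?_) (fun x hx => ?_), ?_⟩
  · rw [hu]
    simp only [potential_semicircle_one hε hρ hd hx, ← hWdef]
    field_simp
    norm_num
  · rw [hu]
    simp only [potential_semicircle_neg_one hε hρ hd hx, ← hWdef]
    field_simp
    norm_num
  · have hgrad (x : Plane) : ‖gradient u x‖ ^ 2 =
        (1 / (2 * W)) ^ 2 * ‖gradient (potential ε ρ d) x‖ ^ 2 := by
      rw [norm_gradient_potential_sq, norm_gradient_sq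
        (a := (1 / (2 * W)) * potentialDx ε ρ d (x 0) (x 1))
        (b := (1 / (2 * W)) * potentialDy ε ρ d (x 0) (x 1))]
      · ring
      · refine (((hasFDerivAt_potential ε ρ d x).const_mul (1 / (2 * W))).const_add
          (1 / 2)).congr_fderiv ?_
        rw [smul_add, smul_smul, smul_smul]
    simp_rw [hgrad]
    rw [integral_const_mul]
    have hE := potential_energy_le hε hd hdρ
    rw [← hTdef] at hE
    calc _ ≤ (1 / (2 * W)) ^ 2 * T := by gcongr
      _ = T / (2 * W) ^ 2 := by ring
      _ ≤ _ := by
        have : 0 < T - 2 := by linarith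
        gcongr

end

/-! ### Two-sided bounds for the capacity -/

lemma capacity_bounds {ε ρ d : ℝ} (hε : 0 < ε) (hd : 0 < d) (hdρ : 2 * d ≤ ρ / 2)
    (hT : 2 < ε / d + 2 * (Real.log (ρ / (4 * d)) / Real.pi)) :
    (resistanceBound ε ρ d)⁻¹ ≤ capacity ε ρ d 0 ∧
      capacity ε ρ d 0 ≤ (ε / d + 2 * (Real.log (ρ / (4 * d)) / Real.pi)) /
        (ε / d + 2 * (Real.log (ρ / (4 * d)) / Real.pi) - 2) ^ 2 := by
  obtain ⟨u, F, hu, hE⟩ := exists_admissible hε hd hdρ hT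
  constructor
  · refine le_csInf ⟨_, u, F, hu, rfl⟩ ?_
    rintro E ⟨v, F', hv, rfl⟩
    exact inv_resistanceBound_le hε hd (by linarith) hv
  · refine le_trans (csInf_le ?_ ⟨u, F, hu, rfl⟩) hE
    refine ⟨0, ?_⟩
    rintro E ⟨v, F', hv, rfl⟩
    exact integral_nonneg fun x => by positivity

/-! ### Asymptotics -/

/-- The leading part of the resistance of the cell. -/
noncomputable def resistance (ε ρ d : ℝ) : ℝ :=
  ε / d + 2 / Real.pi * (Real.log ρ - Real.log d)

/-- The conductance is the inverse of the resistance up to a relative error of the order of that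
inverse; the constants `10` and `32` are not sharp. -/
lemma abs_capacity_mul_resistance_sub_one_le {ε ρ d : ℝ} (hε : 0 < ε) (hd : 0 < d)
    (hdρ : 2 * d ≤ ρ / 2) (hT : 10 ≤ resistance ε ρ d) :
    |capacity ε ρ d 0 * resistance ε ρ d - 1| ≤ 32 / resistance ε ρ d := by
  have hρ : 0 < ρ := by linarith
  have hπ := Real.pi_gt_three
  have hπ4 := Real.pi_le_four
  have hl2 := Real.log_two_lt_d9
  have hl0 : 0 < Real.log 2 := Real.log_pos one_lt_two
  have e1 : resistanceBound ε ρ d = resistance ε ρ d + (Real.pi - 2 * Real.log 2 / Real.pi) := by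
    rw [resistanceBound, resistance, Real.log_div (by positivity) hd.ne',
      Real.log_div hρ.ne' two_ne_zero]
    ring
  have e2 : ε / d + 2 * (Real.log (ρ / (4 * d)) / Real.pi) =
      resistance ε ρ d - 4 * Real.log 2 / Real.pi := by
    have : Real.log 4 = 2 * Real.log 2 := by
      rw [show (4 : ℝ) = 2 ^ 2 by norm_num, Real.log_pow]; norm_num
    rw [resistance, Real.log_div hρ.ne' (by positivity), Real.log_mul (by norm_num) hd.ne', this]
    ring
  have h3 : 4 * Real.log 2 / Real.pi ≤ 2 := by rw [div_le_iff₀ (by positivity)]; linarith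
  have h4 : 0 ≤ 4 * Real.log 2 / Real.pi := by positivity
  have h5 : 0 ≤ 2 * Real.log 2 / Real.pi := by positivity
  have hb := capacity_bounds hε hd hdρ (by rw [e2]; linarith)
  rw [e1, e2] at hb
  set T := resistance ε ρ d
  have hT0 : 0 < T := by linarith
  have hp : 2 * Real.log 2 / Real.pi ≤ 1 := by rw [div_le_iff₀ (by positivity)]; linarith
  have hlow : (T + 4)⁻¹ ≤ capacity ε ρ d 0 := by
    refine le_trans ?_ hb.1
    have : 0 < T + (Real.pi - 2 * Real.log 2 / Real.pi) := by linarith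
    gcongr
    linarith
  have hup : capacity ε ρ d 0 ≤ T / (T - 4) ^ 2 := by
    refine hb.2.trans ?_
    have : 0 < T - 4 := by linarith
    have hn : T - 4 * Real.log 2 / Real.pi ≤ T := sub_le_self _ h4
    have hm : T - 4 ≤ T - 4 * Real.log 2 / Real.pi - 2 := by linarith
    gcongr
  rw [abs_le]
  constructor
  · have h : 1 - 32 / T ≤ (T + 4)⁻¹ * T := by
      rw [inv_mul_eq_div, le_div_iff₀ (by linarith)]
      have : (1 - 32 / T) * (T + 4) = T - 28 - 128 / T := by field_simp; ring
      rw [this]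
      have : 0 ≤ 128 / T := by positivity
      linarith
    have := mul_le_mul_of_nonneg_right hlow hT0.le
    linarith
  · have h : T / (T - 4) ^ 2 * T ≤ 1 + 32 / T := by
      have h4 : 0 < T - 4 := by linarith
      rw [div_mul_eq_mul_div, div_le_iff₀ (by positivity)]
      have : (1 + 32 / T) * (T - 4) ^ 2 = T ^ 2 + 24 * T - 240 + 512 / T := by field_simp; ring
      rw [this]
      have : 0 ≤ 512 / T := by positivity
      nlinarith
    have := mul_le_mul_of_nonneg_right hup hT0.le
    linarith

lemma mul_resistance_eq {ε ρ d : ℝ} (hd : 0 < d) (hd1 : d ≤ 1) :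
    ρ * resistance ε ρ d =
      (qParam ε ρ d)⁻¹ + 2 / Real.pi * (pParam ρ d)⁻¹ + 2 / Real.pi * (ρ * Real.log ρ) := by
  rw [resistance, qParam, pParam, abs_of_nonpos (Real.log_nonpos hd.le hd1)]
  simp only [mul_inv, inv_inv]
  field_simp
  ring

lemma tendsto_qParam_inv {ρ d : ℝ → ℝ} {ε₀ : ℝ} (hε₀ : 0 < ε₀)
    (hd : ∀ ε ∈ Set.Ioc 0 ε₀, 0 < d ε ∧ d ε < ρ ε / 2) {q : ℝ≥0∞} (hq : 0 < q)
    (hq_lim : Tendsto (fun ε => ENNReal.ofReal (qParam ε (ρ ε) (d ε))) (𝓝[>] 0) (𝓝 q)) :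
    Tendsto (fun ε => (qParam ε (ρ ε) (d ε))⁻¹) (𝓝[>] 0) (𝓝 (q⁻¹).toReal) := by
  have h := (ENNReal.tendsto_toReal (ENNReal.inv_ne_top.2 hq.ne')).comp
    (tendsto_inv_iff.2 hq_lim)
  refine h.congr' ?_
  filter_upwards [Ioc_mem_nhdsGT hε₀] with ε hε
  obtain ⟨h1, h2⟩ := hd ε hε
  have h3 : 0 < ρ ε := by linarith
  have h4 : 0 < qParam ε (ρ ε) (d ε) := by
    have := hε.1
    unfold qParam
    positivity
  simp only [Function.comp, ENNReal.toReal_inv, ENNReal.toReal_ofReal h4.le]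

end NeumannSieve

theorem mainTheorem6 (ε₀ : ℝ) (hε₀ : 0 < ε₀) (ρ d : ℝ → ℝ)
    (hd : ∀ ε ∈ Set.Ioc 0 ε₀, 0 < d ε ∧ d ε < ρ ε / 2)
    (hρ : Tendsto ρ (𝓝[>] 0) (𝓝 0))
    (p : ℝ) (hp : 0 < p)
    (hp_lim : Tendsto (fun ε => NeumannSieve.pParam (ρ ε) (d ε)) (𝓝[>] 0) (𝓝 p))
    (q : ℝ≥0∞) (hq : 0 < q)
    (hq_lim : Tendsto (fun ε => ENNReal.ofReal (NeumannSieve.qParam ε (ρ ε) (d ε)))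
      (𝓝[>] 0) (𝓝 q)) :
    ∃ r : ℝ → ℝ,
      r =O[𝓝[>] 0] (fun ε => ρ ε * |Real.log (ρ ε)|
        + |(NeumannSieve.qParam ε (ρ ε) (d ε))⁻¹ - (q⁻¹).toReal|
        + |NeumannSieve.pParam (ρ ε) (d ε) - p|) ∧
      ∀ ε ∈ Set.Ioc 0 ε₀,
        NeumannSieve.capacity ε (ρ ε) (d ε) 0 =
          Real.pi * p / (2 + Real.pi * p * (q⁻¹).toReal) * ρ ε * (1 + r ε) := by
  open NeumannSieve in
  have hπ := Real.pi_pos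
  have hπ3 := Real.pi_gt_three
  set q' := (q⁻¹).toReal with hq'
  have hq0 : 0 ≤ q' := ENNReal.toReal_nonneg
  -- the limit of the resistance, in units of `1 / ρ`
  set D := q' + 2 / Real.pi * p⁻¹ with hD
  have hD0 : 0 < D := by positivity
  have hA : Real.pi * p / (2 + Real.pi * p * q') = D⁻¹ := by
    have : D = (2 + Real.pi * p * q') / (Real.pi * p) := by rw [hD]; field_simp; ring
    rw [this, inv_div]
  have hρ0 : ∀ ε ∈ Set.Ioc 0 ε₀, 0 < ρ ε := fun ε hε => by
    obtain ⟨h1, h2⟩ := hd ε hε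
    linarith
  refine ⟨fun ε => capacity ε (ρ ε) (d ε) 0 * D / ρ ε - 1, ?_, fun ε hε => ?_⟩
  swap
  · have := (hρ0 ε hε).ne'
    rw [hA]
    field_simp
    ring
  have hqi := tendsto_qParam_inv hε₀ hd hq hq_lim
  have hpi : Tendsto (fun ε => (pParam (ρ ε) (d ε))⁻¹) (𝓝[>] 0) (𝓝 p⁻¹) := hp_lim.inv₀ hp.ne'
  have hrl : Tendsto (fun ε => ρ ε * Real.log (ρ ε)) (𝓝[>] 0) (𝓝 0) := by
    simpa [Function.comp_def] using (Real.continuous_mul_log.tendsto 0).comp hρ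
  have hX : Tendsto (fun ε => (qParam ε (ρ ε) (d ε))⁻¹ + 2 / Real.pi * (pParam (ρ ε) (d ε))⁻¹
      + 2 / Real.pi * (ρ ε * Real.log (ρ ε))) (𝓝[>] 0) (𝓝 D) := by
    simpa only [hD, mul_zero, add_zero] using
      (hqi.add (hpi.const_mul (2 / Real.pi))).add (hrl.const_mul (2 / Real.pi))
  -- eventually `log 4 ≤ log (ρ / d)`, because `ρ * log (ρ / d)` tends to `p⁻¹`
  have hY : Tendsto (fun ε => (pParam (ρ ε) (d ε))⁻¹ + ρ ε * Real.log (ρ ε)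
      - ρ ε * Real.log 4) (𝓝[>] 0) (𝓝 p⁻¹) := by
    simpa using (hpi.add hrl).sub (hρ.mul_const (Real.log 4))
  refine IsBigO.of_bound (130 / D + 2 / D * (2 / p ^ 2)) ?_
  filter_upwards [Ioc_mem_nhdsGT hε₀, hX.eventually_const_lt (half_lt_self hD0),
    hY.eventually_const_lt (inv_pos.2 hp), hp_lim.eventually_const_lt (half_lt_self hp),
    hρ.eventually_lt_const (by positivity : 0 < D / 20),
    hρ.eventually_lt_const (Real.exp_pos (-1))] with ε hε hXε hYε hpε hρε hρe
  obtain ⟨hdε, hdρ⟩ := hd ε hε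
  have hρp := hρ0 ε hε
  set R := ρ ε with hR
  set δ := d ε with hδ
  set P := pParam R δ with hP
  set Q := (qParam ε R δ)⁻¹ with hQ
  have hlogR : Real.log R < -1 := (Real.log_lt_iff_lt_exp hρp).2 hρe
  have hδ1 : δ ≤ 1 := by
    have : Real.exp (-1) ≤ 1 := Real.exp_le_one_iff.2 (by norm_num)
    linarith
  have hP0 : 0 < P := by linarith
  have hRX := mul_resistance_eq (ε := ε) (ρ := R) hdε hδ1
  rw [← hP, ← hQ] at hRX
  rw [← hRX] at hXε
  have hPinv : P⁻¹ = -Real.log δ * R := by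
    rw [hP, pParam, mul_inv, inv_inv, inv_inv, abs_of_nonpos (Real.log_nonpos hdε.le hδ1)]
  have h4δ : 2 * δ ≤ R / 2 := by
    have h : R * Real.log 4 ≤ R * (Real.log R - Real.log δ) := by
      rw [hPinv] at hYε
      linarith
    have h' := le_of_mul_le_mul_left h hρp
    rw [← Real.log_div hρp.ne' hdε.ne', Real.log_le_log_iff (by norm_num) (by positivity),
      le_div_iff₀ hdε] at h'
    linarith
  set T := resistance ε R δ with hT
  have hT10 : 10 ≤ T := by
    refine le_of_mul_le_mul_left ?_ hρp
    linarith
  have hcap := abs_capacity_mul_resistance_sub_one_le hε.1 hdε h4δ hT10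
  rw [← hT] at hcap
  set C := capacity ε R δ 0 with hC
  have hT0 : 0 < T := by linarith
  set Bρ := R * |Real.log R| with hBρ
  have hRB : R ≤ Bρ := by
    rw [hBρ, abs_of_neg (by linarith)]
    nlinarith
  have hdiff : |R * T - D| ≤ Bρ + |Q - q'| + 2 / p ^ 2 * |P - p| := by
    have e : R * T - D = 2 / Real.pi * (R * Real.log R) + (Q - q')
        + 2 / Real.pi * (P⁻¹ - p⁻¹) := by rw [hRX, hD]; ring
    have h2π : 2 / Real.pi ≤ 1 := by rw [div_le_one hπ]; linarith
    have b1 : |2 / Real.pi * (R * Real.log R)| ≤ Bρ := by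
      rw [abs_mul, abs_of_pos (by positivity : 0 < 2 / Real.pi), abs_mul, abs_of_pos hρp]
      exact mul_le_of_le_one_left (by positivity) h2π
    have b2 : |2 / Real.pi * (P⁻¹ - p⁻¹)| ≤ 2 / p ^ 2 * |P - p| := by
      have e' : P⁻¹ - p⁻¹ = (p - P) / (P * p) := by field_simp
      rw [abs_mul, abs_of_pos (by positivity : 0 < 2 / Real.pi), e', abs_div, abs_sub_comm p P,
        abs_of_pos (by positivity : 0 < P * p)]
      calc 2 / Real.pi * (|P - p| / (P * p)) ≤ |P - p| / (P * p) :=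
            mul_le_of_le_one_left (by positivity) h2π
        _ ≤ |P - p| / (p / 2 * p) := by gcongr
        _ = _ := by field_simp
    rw [e]
    refine (abs_add_three _ _ _).trans ?_
    linarith
  -- the relative errors of the approximations `C ≈ 1 / T` and `R * T ≈ D`
  have hr : C * D / R - 1 = (C * T - 1) * (D / (R * T)) + (D - R * T) / (R * T) := by
    field_simp
    ring
  have hDX : D / (R * T) ≤ 2 := by
    rw [div_le_iff₀ (by positivity)]
    linarith
  have hTinv : 32 / T ≤ 64 / D * R := by
    rw [div_le_iff₀ hT0, div_mul_eq_mul_div, div_mul_eq_mul_div, le_div_iff₀ hD0]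
    nlinarith
  have hbound : |C * D / R - 1| ≤
      128 / D * Bρ + 2 / D * (Bρ + |Q - q'| + 2 / p ^ 2 * |P - p|) := by
    rw [hr]
    refine (abs_add_le _ _).trans (add_le_add ?_ ?_)
    · rw [abs_mul, abs_of_pos (by positivity : 0 < D / (R * T))]
      calc |C * T - 1| * (D / (R * T)) ≤ (64 / D * R) * 2 := by
            gcongr
            exact hcap.trans hTinv
        _ = 128 / D * R := by ring
        _ ≤ _ := by gcongr
    · rw [abs_div, abs_sub_comm, abs_of_pos (by positivity : 0 < R * T)]
      calc |R * T - D| / (R * T) ≤ |R * T - D| / (D / 2) := by gcongr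
        _ = 2 / D * |R * T - D| := by field_simp
        _ ≤ _ := by gcongr
  have hB0 : 0 ≤ Bρ := hρp.le.trans hRB
  rw [Real.norm_eq_abs, Real.norm_of_nonneg (by positivity)]
  refine hbound.trans ?_
  have e : (130 / D + 2 / D * (2 / p ^ 2)) * (Bρ + |Q - q'| + |P - p|) =
      128 / D * Bρ + 2 / D * (Bρ + |Q - q'| + 2 / p ^ 2 * |P - p|) +
      (2 / D * (2 / p ^ 2) * (Bρ + |Q - q'|) + 128 / D * |Q - q'| + 130 / D * |P - p|) := by
    ring
  rw [e]
  exact le_add_of_nonneg_right (by positivity)
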